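/- Let $a_{11}\in\mathbf R$ and $a_{02}>0$, and let $$f_0(u,v)=\tfrac12(0,0,a_{02}v^2)+u\,(1,v,a_{11}v)$$ be the corresponding degenerate quadratic cross cap. A $C^\infty$-map $f$ from a domain of $\mathbf R^2$ to $\mathbf R^3$ has a cross cap singularity at $p$ if there are local $C^\infty$-diffeomorphisms $\phi$ of $(\mathbf R^2,p)$ to $(\mathbf R^2,0)$ and $\Phi$ of $(\mathbf R^3,f(p))$ to $(\mathbf R^3,0)$ with $\Phi\circ f=f_{\mathrm{std}}\circ\phi$ near $p$, where $f_{\mathrm{std}}(u,v)=(u,uv,v^2)$. Two $C^\infty$-maps $\mathbf R^2\to\mathbf R^3$ with cross cap singularities at the origin are isometric if their first fundamental forms (in the same coordinates $u,v$) coincide. Two maps $f,g:\mathbf R^2\to\mathbf R^3$ are congruent if $g=T\circ f$ for an orientation-preserving isometry $T$ of $\mathbf R^3$, and two parametrized curves $c_1,c_2$ in the unit sphere $S^2$ are congruent in $S^2$ if $c_2=A\circ c_1$ for a rotation $A\in SO(3)$. Let $c(s)$ $(|s|<\pi/2)$ be a $C^\infty$-curve in the unit sphere $S^2\subset\mathbf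 R^3$ parametrized by arc length. Set $$\xi(v)=\sqrt{1+(1+a_{11}^2)v^2}\;c\bigl(\arctan(v\sqrt{1+a_{11}^2})\bigr),\qquad B(v)=a_{11}\xi'(v)+\xi(v)\times\xi'(v),$$ $$\gamma(v)=\frac{a_{02}}{1+a_{11}^2}\int_0^v tB(t)\,dt,\qquad f_c(u,v)=\gamma(v)+u\,\xi(v)\qquad (u,v\in\mathbf R).$$ Then: 1. $f_c:\mathbf R^2\to\mathbf R^3$ is $C^\infty$, has a cross cap singularity at the origin, and is isometric to $f_0$ (which also has a cross cap singularity at the origin). 2. If $c_1,c_2$ are two such curves, then $f_{c_1}$ is congruent to $f_{c_2}$ if and only if $c_1$ is congruent to $c_2$ in $S^2$. Moreover, if $f_{c_2}=T\circ f_{c_1}$ for any isometry $T$ of $\mathbf R^3$, orientation-preserving or not, then $f_{c_1}$ and $f_{c_2}$ are congruent. 3. $f_c$ is congruent to $f_0$ if and only if $c$ is a geodesic of $S^2$. 4. Consequently $f_0$ has isometric deformations with infinite-dimensional freedom: for every $N\ge 0$ there is a family $(c_t)_{t\in\mathbf R^N}$ of such curves such that $f_{c_0}=f_0$, the map $(t,u,v)\mapsto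 f_{c_t}(u,v)$ is $C^\infty$, every $f_{c_t}$ is isometric to $f_0$, and $f_{c_t}$ and $f_{c_{t'}}$ are not congruent for $t\ne t'$. -/

import Mathlib

open scoped ContDiff

noncomputable section

namespace CrossCap

/-- Euclidean three-space. -/
abbrev E3 := EuclideanSpace ℝ (Fin 3)

/-- The vector product of Euclidean three-space. -/
def cross (x y : E3) : E3 := WithLp.toLp 2 (crossProduct x.ofLp y.ofLp)

/-- The partial derivative `f_u` of a map of the `(u, v)`-plane. -/
def partialU (f : ℝ × ℝ → E3) (p : ℝ × ℝ) : E3 := fderiv ℝ f p (1, 0)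

/-- The partial derivative `f_v` of a map of the `(u, v)`-plane. -/
def partialV (f : ℝ × ℝ → E3) (p : ℝ × ℝ) : E3 := fderiv ℝ f p (0, 1)

/-- The standard cross cap `(u, v) ↦ (u, uv, v²)`. -/
def fStd (p : ℝ × ℝ) : E3 := !₂[p.1, p.1 * p.2, p.2 ^ 2]

/-- `f` has a cross cap singularity at `p`: there are a local diffeomorphism `φ` of the plane at `p`
and a local diffeomorphism `Φ` of space at `f p`, sending these points to the respective origins,
such that `Φ ∘ f = fStd ∘ φ` near `p`. -/
def IsCrossCapAt (f : ℝ × ℝ → E3) (p : ℝ × ℝ) : Prop :=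
  ∃ (φ : OpenPartialHomeomorph (ℝ × ℝ) (ℝ × ℝ)) (Φ : OpenPartialHomeomorph E3 E3),
    ContDiffOn ℝ ∞ φ φ.source ∧ ContDiffOn ℝ ∞ φ.symm φ.target ∧
    ContDiffOn ℝ ∞ Φ Φ.source ∧ ContDiffOn ℝ ∞ Φ.symm Φ.target ∧
    p ∈ φ.source ∧ φ p = 0 ∧
    f p ∈ Φ.source ∧ Φ (f p) = 0 ∧
    Set.MapsTo f φ.source Φ.source ∧
    ∀ q ∈ φ.source, Φ (f q) = fStd (φ q)

/-- Two smooth maps of the `(u, v)`-plane with a cross cap singularity at the origin are isometric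
if they have the same first fundamental form. -/
structure IsIsometric (f g : ℝ × ℝ → E3) : Prop where
  smooth_left : ContDiff ℝ ∞ f
  smooth_right : ContDiff ℝ ∞ g
  crossCap_left : IsCrossCapAt f 0
  crossCap_right : IsCrossCapAt g 0
  uu : ∀ p, inner ℝ (partialU f p) (partialU f p) = inner ℝ (partialU g p) (partialU g p)
  uv : ∀ p, inner ℝ (partialU f p) (partialV f p) = inner ℝ (partialU g p) (partialV g p)
  vv : ∀ p, inner ℝ (partialV f p) (partialV f p) = inner ℝ (partialV g p) (partialV g p)

/-- An isometric deformation with `N` real parameters: a smooth family all of whose members are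
isometric (as maps with a cross cap singularity at the origin) to the member at `0`. -/
structure IsIsometricDeformation {N : ℕ} (F : EuclideanSpace ℝ (Fin N) → ℝ × ℝ → E3) : Prop where
  smooth : ContDiff ℝ ∞ (fun q : EuclideanSpace ℝ (Fin N) × (ℝ × ℝ) => F q.1 q.2)
  isometric : ∀ t, IsIsometric (F t) (F 0)

/-- Two maps of the plane into space are congruent if they differ by an orientation-preserving
isometry of space. -/
def Congruent (f g : ℝ × ℝ → E3) : Prop :=
  ∃ (A : E3 ≃ₗᵢ[ℝ] E3) (b : E3),
    LinearMap.det (A.toLinearEquiv : E3 →ₗ[ℝ] E3) = 1 ∧ ∀ p, g p = A (f p) + b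

/-- The parameter interval `|s| < π / 2` of the spherical curves. -/
def arcInterval : Set ℝ := Set.Ioo (-(Real.pi / 2)) (Real.pi / 2)

/-- `c`, restricted to `|s| < π / 2`, is a smooth curve in the unit sphere, parametrized by arc
length (hence regular). The values of `c` outside the interval play no role. -/
structure IsSphericalCurve (c : ℝ → E3) : Prop where
  smooth : ContDiffOn ℝ ∞ c arcInterval
  mem_sphere : ∀ s ∈ arcInterval, c s ∈ Metric.sphere (0 : E3) 1
  unit_speed : ∀ s ∈ arcInterval, ‖deriv c s‖ = 1

/-- Two spherical curves on `|s| < π / 2` are congruent if they differ by an orientation-preserving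
isometry of the sphere, that is, by a rotation. -/
def CurveCongruent (c₁ c₂ : ℝ → E3) : Prop :=
  ∃ A : E3 ≃ₗᵢ[ℝ] E3,
    LinearMap.det (A.toLinearEquiv : E3 →ₗ[ℝ] E3) = 1 ∧ ∀ s ∈ arcInterval, c₂ s = A (c₁ s)

/-- A curve in the unit sphere is a geodesic if its covariant acceleration, the part of `c''`
tangent to the sphere, vanishes. -/
def IsSphericalGeodesic (c : ℝ → E3) : Prop :=
  ∀ s ∈ arcInterval, deriv (deriv c) s - inner ℝ (deriv (deriv c) s) (c s) • c s = 0

/-- The degenerate quadratic cross cap with coefficients `a₁₁` and `a₀₂`. -/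
def f₀ (a₁₁ a₀₂ : ℝ) (p : ℝ × ℝ) : E3 :=
  (1 / 2 : ℝ) • !₂[0, 0, a₀₂ * p.2 ^ 2] + p.1 • !₂[1, p.2, a₁₁ * p.2]

/-- `ĉ(v) = c(arctan(v √(1 + a₁₁²)))`. -/
def cHat (a₁₁ : ℝ) (c : ℝ → E3) (v : ℝ) : E3 :=
  c (Real.arctan (v * √(1 + a₁₁ ^ 2)))

/-- `ξ(v) = √(1 + (1 + a₁₁²) v²) ĉ(v)`. -/
def xi (a₁₁ : ℝ) (c : ℝ → E3) (v : ℝ) : E3 :=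
  √(1 + (1 + a₁₁ ^ 2) * v ^ 2) • cHat a₁₁ c v

/-- `B = a₁₁ ξ' + ξ × ξ'`. -/
def B (a₁₁ : ℝ) (c : ℝ → E3) (v : ℝ) : E3 :=
  a₁₁ • deriv (xi a₁₁ c) v + cross (xi a₁₁ c v) (deriv (xi a₁₁ c) v)

/-- `γ(v) = a₀₂ / (1 + a₁₁²) ∫₀ᵛ t B(t) dt`. -/
def gam (a₁₁ a₀₂ : ℝ) (c : ℝ → E3) (v : ℝ) : E3 :=
  (a₀₂ / (1 + a₁₁ ^ 2)) • ∫ t in (0 : ℝ)..v, t • B a₁₁ c t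

/-- The ruled surface `f_c(u, v) = γ(v) + u ξ(v)`. -/
def ruled (a₁₁ a₀₂ : ℝ) (c : ℝ → E3) (p : ℝ × ℝ) : E3 :=
  gam a₁₁ a₀₂ c p.2 + p.1 • xi a₁₁ c p.2

end CrossCap

end

/-!
Since `|ξ|² = 1 + (1 + a₁₁²) v²`, `|ξ'|² = 1 + a₁₁²` and the products of `B` with `ξ`, `ξ'` and `B`
do not depend on the unit speed curve `c`, all surfaces `f_c` have the same first fundamental form,
and a great circle gives `f₀`.

At the origin, `f_c` has a curve of double points: for suitable smooth functions `s`, `v` with `s`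
even, the points of parameters `(s y, v y)` and `(s (-y), v (-y))` coincide. Along it,
`f_c (s y + x, v y)` is the sum of an even function of `y` and `x` times the sum of an even and an
odd one, so that, by Whitney's theorem, it has the form `A (y²) + x P (y²) + x y Q (y²)` with smooth
`A`, `P`, `Q`. This is a local diffeomorphism of space applied to the standard cross cap.

An isometry between two surfaces `f_c` fixes the origin and matches the rulings, hence the curves;
it preserves the orientation because `B` contains one vector product. Bending a great circle along
half of its length, with a latitude that has `N` free coefficients, gives the deformations: the
straight half leaves no room for a nontrivial rotation.
-/

noncomputable section

namespace CrossCap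

open MeasureTheory Filter Topology Set

section ParametricIntegrals

universe u v

theorem hasFDerivAt_intervalIntegral_of_continuous {X E : Type*} [NormedAddCommGroup X]
    [NormedSpace ℝ X] [NormedAddCommGroup E] [NormedSpace ℝ E] {F : X → ℝ → E}
    {F' : X → ℝ → X →L[ℝ] E} (hF : Continuous (Function.uncurry F))
    (hF' : Continuous (Function.uncurry F'))
    (hderiv : ∀ x t, HasFDerivAt (fun x => F x t) (F' x t) x) (a b : ℝ) (x₀ : X) :
    HasFDerivAt (fun x => ∫ t in a..b, F x t) (∫ t in a..b, F' x₀ t) x₀ := by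
  obtain ⟨C, hC⟩ := (isCompact_uIcc (a := a) (b := b)).exists_bound_of_continuousOn
    (hF'.comp (Continuous.prodMk_right x₀)).continuousOn
  have hbound : ∀ᶠ x in 𝓝 x₀, ∀ t ∈ uIcc a b, ‖F' x t‖ < C + 1 :=
    isCompact_uIcc.eventually_forall_of_forall_eventually fun t ht =>
      hF'.norm.continuousAt.eventually_lt_const ((hC t ht).trans_lt (lt_add_one C))
  have hFx : ∀ x, Continuous (F x) := fun x => hF.comp (Continuous.prodMk_right x)
  exact intervalIntegral.hasFDerivAt_integral_of_dominated_of_fderiv_le (bound := fun _ => C + 1)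
    hbound (Eventually.of_forall fun x => (hFx x).aestronglyMeasurable)
    ((hFx x₀).intervalIntegrable _ _)
    (hF'.comp (Continuous.prodMk_right x₀)).aestronglyMeasurable
    (Eventually.of_forall fun t ht x hx => (hx t (uIoc_subset_uIcc ht)).le)
    intervalIntegrable_const (Eventually.of_forall fun t _ x _ => hderiv x t)

theorem contDiff_nat_parametric_intervalIntegral {X : Type u} [NormedAddCommGroup X]
    [NormedSpace ℝ X] (a b : ℝ) (n : ℕ) :
    ∀ {E : Type max u v} [NormedAddCommGroup E] [NormedSpace ℝ E] {F : X × ℝ → E},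
      ContDiff ℝ n F → ContDiff ℝ n (fun x => ∫ t in a..b, F (x, t)) := by
  induction n with
  | zero =>
    intro E _ _ F hF
    rw [Nat.cast_zero, contDiff_zero] at hF ⊢
    exact intervalIntegral.continuous_parametric_intervalIntegral_of_continuous'
      (f := fun x t => F (x, t)) hF a b
  | succ n ih =>
    intro E _ _ F hF
    rw [Nat.cast_add, Nat.cast_one] at hF ⊢
    let F' : X × ℝ → X →L[ℝ] E := fun q => (fderiv ℝ F q).comp (ContinuousLinearMap.inl ℝ X ℝ)
    have hF' : ContDiff ℝ n F' := (contDiff_succ_iff_fderiv.1 hF).2.2.clm_comp contDiff_const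
    have hderiv : ∀ x t, HasFDerivAt (fun x => F (x, t)) (F' (x, t)) x := fun x t =>
      ((contDiff_succ_iff_fderiv.1 hF).1 (x, t)).hasFDerivAt.comp x (hasFDerivAt_prodMk_left x t)
    exact contDiff_succ_iff_hasFDerivAt.2 ⟨fun x => ∫ t in a..b, F' (x, t), ih hF',
      hasFDerivAt_intervalIntegral_of_continuous (F := fun x t => F (x, t))
        (F' := fun x t => F' (x, t)) hF.continuous hF'.continuous hderiv a b⟩

variable {X : Type u} [NormedAddCommGroup X] [NormedSpace ℝ X]
  {E : Type v} [NormedAddCommGroup E] [NormedSpace ℝ E] {F : X × ℝ → E}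

theorem contDiff_parametric_intervalIntegral {n : ℕ∞} (hF : ContDiff ℝ n F) (a b : ℝ) :
    ContDiff ℝ n (fun x => ∫ t in a..b, F (x, t)) := by
  -- the induction on `n` takes place in a universe containing `X →L[ℝ] E`
  let L : E ≃L[ℝ] ULift.{u} E := ContinuousLinearEquiv.ulift.symm
  refine contDiff_iff_forall_nat_le.2 fun m hm => (L.comp_contDiff_iff).1 ?_
  have hL : ContDiff ℝ m fun x => ∫ t in a..b, L (F (x, t)) :=
    contDiff_nat_parametric_intervalIntegral.{u, v} a b m
      (L.contDiff.comp (hF.of_le (mod_cast hm)))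
  simpa only [intervalIntegral, L.integral_comp_comm, ← map_sub, Function.comp_def] using hL

theorem contDiff_parametric_primitive {n : ℕ∞} (hF : ContDiff ℝ n F) (a : ℝ) :
    ContDiff ℝ n (fun q : X × ℝ => ∫ t in a..q.2, F (q.1, t)) := by
  have h : (fun q : X × ℝ => ∫ t in a..q.2, F (q.1, t)) =
      fun q => (q.2 - a) • ∫ t in (0 : ℝ)..1, F (q.1, a + (q.2 - a) * t) := by
    funext q
    rw [intervalIntegral.smul_integral_comp_add_mul (fun t => F (q.1, t))]
    simp
  rw [h]
  exact (contDiff_snd.sub contDiff_const).smul (contDiff_parametric_intervalIntegral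
    (F := fun r : (X × ℝ) × ℝ => F (r.1.1, a + (r.1.2 - a) * r.2)) (by fun_prop) 0 1)

end ParametricIntegrals

section Borel

variable {E : Type*} [NormedAddCommGroup E] [NormedSpace ℝ E]

theorem exists_norm_iteratedDeriv_le_of_hasCompactSupport {p : ℝ → E} (hp : ContDiff ℝ ∞ p)
    (hsupp : HasCompactSupport p) (j : ℕ) : ∃ M, ∀ x, ‖iteratedDeriv j p x‖ ≤ M := by
  simp_rw [← norm_iteratedFDeriv_eq_norm_iteratedDeriv]
  exact (hsupp.iteratedFDeriv j).exists_bound_of_continuous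
    (hp.continuous_iteratedFDeriv (mod_cast le_top))

theorem exists_hasCompactSupport_iteratedDeriv_zero_eq_ite (k : ℕ) :
    ∃ p : ℝ → ℝ, ContDiff ℝ ∞ p ∧ HasCompactSupport p ∧
      ∀ n, iteratedDeriv n p 0 = if n = k then 1 else 0 := by
  obtain ⟨χ⟩ : Nonempty (ContDiffBump (0 : ℝ)) := inferInstance
  refine ⟨fun x => (k.factorial : ℝ)⁻¹ * x ^ k * χ x,
    (contDiff_const.mul (contDiff_id.pow k)).mul χ.contDiff, χ.hasCompactSupport.mul_left,
    fun n => ?_⟩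
  have hmonomial : (fun x => (k.factorial : ℝ)⁻¹ * x ^ k * χ x) =ᶠ[𝓝 0]
      fun x => (k.factorial : ℝ)⁻¹ * x ^ k := by
    filter_upwards [χ.eventuallyEq_one] with x hx
    rw [hx, Pi.one_apply, mul_one]
  rw [hmonomial.iteratedDeriv_eq, iteratedDeriv_const_mul_field, iteratedDeriv_fun_pow_zero]
  split_ifs with h
  · exact inv_mul_cancel₀ (by positivity)
  · simp

theorem iteratedDeriv_rescale {p : ℝ → ℝ} (hp : ContDiff ℝ ∞ p) (l : ℝ) (k j : ℕ) (x : ℝ) :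
    iteratedDeriv j (fun x => l⁻¹ ^ k * p (l * x)) x =
      l⁻¹ ^ k * (l ^ j * iteratedDeriv j p (l * x)) := by
  rw [iteratedDeriv_const_mul_field, iteratedDeriv_comp_const_mul (hp.of_le (mod_cast le_top))]

theorem inv_pow_mul_pow_le_inv {l : ℝ} (hl : 1 ≤ l) {j k : ℕ} (hjk : j < k) :
    l⁻¹ ^ k * l ^ j ≤ l⁻¹ := by
  obtain ⟨d, rfl⟩ := Nat.exists_eq_add_of_lt hjk
  have hl0 : l ≠ 0 := (one_pos.trans_le hl).ne'
  calc l⁻¹ ^ (j + d + 1) * l ^ j = l⁻¹ * l⁻¹ ^ d := by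
        rw [pow_succ, pow_add, inv_pow l j]
        field_simp
    _ ≤ l⁻¹ := mul_le_of_le_one_right (by positivity)
        (pow_le_one₀ (by positivity) (inv_le_one_of_one_le₀ hl))

/-- Rescaling `p` to `l⁻ᵏ p(l x)` keeps the `k`-th derivative at `0` and divides the lower ones by
at least `l`. -/
theorem exists_iteratedDeriv_zero_eq_ite_of_norm_le (k : ℕ) {ε : ℝ} (hε : 0 < ε) :
    ∃ q : ℝ → ℝ, ContDiff ℝ ∞ q ∧ (∀ n, iteratedDeriv n q 0 = if n = k then 1 else 0) ∧
      (∀ j, ∃ M, ∀ x, ‖iteratedDeriv j q x‖ ≤ M) ∧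
      ∀ j < k, ∀ x, ‖iteratedDeriv j q x‖ ≤ ε := by
  obtain ⟨p, hp, hsupp, hp0⟩ := exists_hasCompactSupport_iteratedDeriv_zero_eq_ite k
  choose M hM using exists_norm_iteratedDeriv_le_of_hasCompactSupport hp hsupp
  have hM0 : ∀ j, 0 ≤ M j := fun j => (norm_nonneg _).trans (hM j 0)
  let C : ℝ := ∑ j ∈ Finset.range k, M j
  have hC : 0 ≤ C := Finset.sum_nonneg fun j _ => hM0 j
  let l : ℝ := 1 + C / ε
  have hl : 1 ≤ l := le_add_of_nonneg_right (by positivity)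
  have hl0 : 0 < l := one_pos.trans_le hl
  have hbound : ∀ j x, ‖iteratedDeriv j (fun x => l⁻¹ ^ k * p (l * x)) x‖ ≤
      l⁻¹ ^ k * l ^ j * M j := fun j x => by
    rw [iteratedDeriv_rescale hp, ← mul_assoc, norm_mul, Real.norm_of_nonneg (by positivity)]
    gcongr
    exact hM j _
  refine ⟨fun x => l⁻¹ ^ k * p (l * x),
    contDiff_const.mul (hp.comp (contDiff_const.mul contDiff_id)), fun n => ?_,
    fun j => ⟨_, hbound j⟩, fun j hj x => (hbound j x).trans ?_⟩
  · rw [iteratedDeriv_rescale hp, mul_zero, hp0]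
    split_ifs with h
    · rw [h, mul_one, ← mul_pow, inv_mul_cancel₀ hl0.ne', one_pow]
    · simp
  · calc l⁻¹ ^ k * l ^ j * M j ≤ l⁻¹ * C :=
          mul_le_mul (inv_pow_mul_pow_le_inv hl hj)
            (Finset.single_le_sum (fun j _ => hM0 j) (Finset.mem_range.2 hj)) (hM0 j)
            (by positivity)
      _ ≤ ε := by
          rw [inv_mul_le_iff₀ hl0, add_mul, div_mul_cancel₀ C hε.ne']
          linarith

theorem iteratedDeriv_tsum_apply [CompleteSpace E] {f : ℕ → ℝ → E} {v : ℕ → ℕ → ℝ}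
    (hf : ∀ k, ContDiff ℝ ∞ (f k)) (hv : ∀ j, Summable (v j))
    (hfv : ∀ j k x, ‖iteratedFDeriv ℝ j (f k) x‖ ≤ v j k) (n : ℕ) (x : ℝ) :
    iteratedDeriv n (fun x => ∑' k, f k x) x = ∑' k, iteratedDeriv n (f k) x := by
  have hsum : Summable fun k => iteratedFDeriv ℝ n (f k) x :=
    (hv n).of_norm_bounded fun k => hfv n k x
  simp only [iteratedDeriv_eq_iteratedFDeriv]
  rw [iteratedFDeriv_tsum_apply (N := ⊤) hf (fun j _ => hv j) (fun j k x _ => hfv j k x) le_top]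
  exact (ContinuousMultilinearMap.apply ℝ (fun _ : Fin n => ℝ) E fun _ => 1).map_tsum hsum

theorem iteratedDeriv_smul_vector {q : ℝ → ℝ} (hq : ContDiff ℝ ∞ q) (a : E) (j : ℕ) (x : ℝ) :
    iteratedDeriv j (fun x => q x • a) x = iteratedDeriv j q x • a :=
  iteratedDeriv_smul_const (hq.of_le (mod_cast le_top)).contDiffAt a

/-- **Borel's lemma** -/
theorem exists_contDiff_iteratedDeriv_zero_eq [CompleteSpace E] (a : ℕ → E) :
    ∃ b : ℝ → E, ContDiff ℝ ∞ b ∧ ∀ n, iteratedDeriv n b 0 = a n := by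
  let ε : ℕ → ℝ := fun k => (1 / 2) ^ k / (1 + ‖a k‖)
  have hε : ∀ k, 0 < ε k := fun k => by positivity
  choose q hq hq0 hqM hqε using
    fun k => exists_iteratedDeriv_zero_eq_ite_of_norm_le k (hε k)
  choose M hM using hqM
  let f : ℕ → ℝ → E := fun k x => q k x • a k
  have hf : ∀ k, ContDiff ℝ ∞ (f k) := fun k => (hq k).smul contDiff_const
  let v : ℕ → ℕ → ℝ := fun j k => if j < k then (1 / 2) ^ k else M k j * ‖a k‖
  have hv : ∀ j, Summable (v j) := fun j => by
    refine (summable_congr_cofinite (f := fun k : ℕ => ((1 : ℝ) / 2) ^ k) ?_).1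
      summable_geometric_two
    rw [Nat.cofinite_eq_atTop]
    filter_upwards [eventually_gt_atTop j] with k hk
    simp only [v, hk, if_true]
  have hfv : ∀ j k x, ‖iteratedFDeriv ℝ j (f k) x‖ ≤ v j k := fun j k x => by
    rw [norm_iteratedFDeriv_eq_norm_iteratedDeriv, iteratedDeriv_smul_vector (hq k), norm_smul]
    by_cases hjk : j < k
    · simp only [v, hjk, if_true]
      calc ‖iteratedDeriv j (q k) x‖ * ‖a k‖ ≤ ε k * (1 + ‖a k‖) :=
            mul_le_mul (hqε k j hjk x) (by linarith) (norm_nonneg _) (hε k).le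
        _ = (1 / 2) ^ k := div_mul_cancel₀ _ (by positivity)
    · simp only [v, hjk, if_false]
      gcongr
      exact hM k j x
  refine ⟨fun x => ∑' k, f k x,
    contDiff_tsum (N := ⊤) hf (fun j _ => hv j) fun j k x _ => hfv j k x, fun n => ?_⟩
  calc iteratedDeriv n (fun x => ∑' k, f k x) 0 = ∑' k, iteratedDeriv n (f k) 0 :=
        iteratedDeriv_tsum_apply hf hv hfv n 0
    _ = ∑' k, (if n = k then (1 : ℝ) else 0) • a k :=
        tsum_congr fun k => by rw [iteratedDeriv_smul_vector (hq k), hq0]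
    _ = a n := by
        rw [tsum_eq_single n fun k hk => by rw [if_neg hk.symm, zero_smul], if_pos rfl, one_smul]

end Borel

section Even

theorem even_add_comp_neg {G M : Type*} [InvolutiveNeg G] [AddCommMagma M] (h : G → M) :
    Function.Even fun y => h y + h (-y) := fun y => by
  simp only [neg_neg, add_comm]

theorem odd_sub_comp_neg {G M : Type*} [InvolutiveNeg G] [SubtractionMonoid M] (h : G → M) :
    Function.Odd fun y => h y - h (-y) := fun y => by
  simp only [neg_neg, neg_sub]

variable {E : Type*} [NormedAddCommGroup E] [NormedSpace ℝ E] {h : ℝ → E}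

theorem contDiff_infty_deriv (hh : ContDiff ℝ ∞ h) : ContDiff ℝ ∞ (deriv h) :=
  (contDiff_infty_iff_deriv.1 hh).2

theorem hasDerivAt_of_contDiff_infty (hh : ContDiff ℝ ∞ h) (x : ℝ) :
    HasDerivAt h (deriv h x) x :=
  ((contDiff_infty_iff_deriv.1 hh).1 x).hasDerivAt

theorem hasDerivAt_iteratedDeriv (hh : ContDiff ℝ ∞ h) (n : ℕ) (x : ℝ) :
    HasDerivAt (iteratedDeriv n h) (iteratedDeriv (n + 1) h x) x := by
  rw [iteratedDeriv_succ, iteratedDeriv_eq_iterate]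
  exact hasDerivAt_of_contDiff_infty (hh.iterate_deriv n) x

theorem contDiff_infty_of_hasDerivAt_succ {f : ℕ → ℝ → E}
    (hf : ∀ n x, HasDerivAt (f n) (f (n + 1) x) x) (n : ℕ) : ContDiff ℝ ∞ (f n) := by
  refine contDiff_infty.2 fun m => ?_
  induction m generalizing n with
  | zero => exact contDiff_zero.2 (continuous_iff_continuousAt.2 fun x => (hf n x).continuousAt)
  | succ m ih =>
    rw [Nat.cast_add, Nat.cast_one, contDiff_succ_iff_deriv]
    refine ⟨fun x => (hf n x).differentiableAt, by simp, ?_⟩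
    rw [show deriv (f n) = f (n + 1) from funext fun x => (hf n x).deriv]
    exact ih (n + 1)

theorem exists_contDiff_eqOn_Ici [CompleteSpace E] {f : ℕ → ℝ → E}
    (hcont : ∀ n, ContinuousOn (f n) (Ici 0))
    (hderiv : ∀ n, ∀ x > 0, HasDerivAt (f n) (f (n + 1) x) x) :
    ∃ g : ℝ → E, ContDiff ℝ ∞ g ∧ EqOn g (f 0) (Ici 0) := by
  obtain ⟨b, hb, hb0⟩ := exists_contDiff_iteratedDeriv_zero_eq fun n => f n 0
  let G : ℕ → ℝ → E := fun n x => if 0 ≤ x then f n x else iteratedDeriv n b x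
  have hG_of_nonneg : ∀ n, ∀ x ≥ 0, G n x = f n x := fun n x hx => if_pos hx
  have hG_of_neg : ∀ n, ∀ x < 0, G n x = iteratedDeriv n b x := fun n x hx => if_neg hx.not_ge
  have hG_cont : ∀ n, Continuous (G n) := fun n =>
    continuous_if_le continuous_const continuous_id (hcont n)
      (hb.continuous_iteratedDeriv n (mod_cast le_top)).continuousOn
      fun x hx => by rw [← show (0 : ℝ) = x from hx, hb0]
  have hG_deriv_ne : ∀ n, ∀ x ≠ 0, HasDerivAt (G n) (G (n + 1) x) x := fun n x hx => by
    rcases hx.lt_or_gt with hx | hx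
    · rw [hG_of_neg _ x hx]
      exact (hasDerivAt_iteratedDeriv hb n x).congr_of_eventuallyEq
        ((eventually_lt_nhds hx).mono (hG_of_neg n))
    · rw [hG_of_nonneg _ x hx.le]
      exact (hderiv n x hx).congr_of_eventuallyEq
        ((eventually_gt_nhds hx).mono fun y hy => hG_of_nonneg n y (le_of_lt hy))
  have hG_deriv : ∀ n x, HasDerivAt (G n) (G (n + 1) x) x := fun n =>
    hasDerivAt_of_hasDerivAt_of_ne' (hG_deriv_ne n) (hG_cont n).continuousAt
      (hG_cont (n + 1)).continuousAt
  exact ⟨G 0, contDiff_infty_of_hasDerivAt_succ hG_deriv 0, hG_of_nonneg 0⟩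

theorem odd_deriv_of_even (he : Function.Even h) : Function.Odd (deriv h) := fun y => by
  rw [eq_neg_iff_add_eq_zero, add_comm, ← eq_neg_iff_add_eq_zero, ← deriv_comp_neg, funext he]

theorem apply_zero_of_odd (ho : Function.Odd h) : h 0 = 0 := by
  have h0 : (2 : ℝ) • h 0 = 0 := by
    rw [two_smul, ← eq_neg_iff_add_eq_zero, ← ho, neg_zero]
  exact (smul_eq_zero.1 h0).resolve_left two_ne_zero

theorem even_dslope_of_odd (ho : Function.Odd h) : Function.Even (dslope h 0) := fun y => by
  rcases eq_or_ne y 0 with rfl | hy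
  · rw [neg_zero]
  · rw [dslope_of_ne h hy, dslope_of_ne h (neg_ne_zero.2 hy), slope_def_module, slope_def_module,
      ho, apply_zero_of_odd ho]
    simp [inv_neg]

theorem smul_dslope_of_odd (ho : Function.Odd h) (y : ℝ) : y • dslope h 0 y = h y := by
  simpa only [sub_zero] using sub_smul_dslope_of_zero (apply_zero_of_odd ho) y

/-- The derivative of an even function with respect to the square of its argument, that is
`h'(y) / (2 y)`, extended continuously to `y = 0`. -/
def sqDeriv (h : ℝ → E) (y : ℝ) : E := (1 / 2 : ℝ) • dslope (deriv h) 0 y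

theorem even_sqDeriv (he : Function.Even h) : Function.Even (sqDeriv h) := fun y => by
  rw [sqDeriv, even_dslope_of_odd (odd_deriv_of_even he), sqDeriv]

theorem hasDerivAt_comp_sq (hh : ContDiff ℝ ∞ h) (y : ℝ) :
    HasDerivAt (fun y => h (y ^ 2)) ((2 * y) • deriv h (y ^ 2)) y := by
  simpa [Function.comp_def] using
    (hasDerivAt_of_contDiff_infty hh (y ^ 2)).scomp y (hasDerivAt_pow 2 y)

theorem deriv_deriv_comp_sq_zero (hh : ContDiff ℝ ∞ h) :
    deriv (deriv fun y => h (y ^ 2)) 0 = (2 : ℝ) • deriv h 0 := by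
  have hderiv : deriv (fun y => h (y ^ 2)) = fun y => (2 * y) • deriv h (y ^ 2) :=
    funext fun y => (hasDerivAt_comp_sq hh y).deriv
  rw [hderiv]
  exact ((((hasDerivAt_id (0 : ℝ)).const_mul 2).smul
    (hasDerivAt_comp_sq (contDiff_infty_deriv hh) 0)).congr_deriv (by simp)).deriv

theorem deriv_eq_smul_sqDeriv (he : Function.Even h) (y : ℝ) :
    deriv h y = (2 * y) • sqDeriv h y := by
  rw [← smul_dslope_of_odd (odd_deriv_of_even he), sqDeriv, smul_smul]
  ring_nf

theorem hasDerivAt_comp_sqrt_of_even (hh : ContDiff ℝ ∞ h) (he : Function.Even h) {w : ℝ}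
    (hw : 0 < w) : HasDerivAt (fun w => h √w) (sqDeriv h √w) w := by
  have hsqrt : √w ≠ 0 := (Real.sqrt_pos.2 hw).ne'
  have hcomp := (hasDerivAt_of_contDiff_infty hh √w).scomp w (Real.hasDerivAt_sqrt hw.ne')
  rwa [deriv_eq_smul_sqDeriv he, smul_smul, one_div_mul_cancel (by simpa using hsqrt),
    one_smul] at hcomp

variable [CompleteSpace E]

theorem dslope_eq_integral_deriv (hh : ContDiff ℝ 1 h) (a y : ℝ) :
    dslope h a y = ∫ t in (0 : ℝ)..1, deriv h (a + (y - a) * t) := by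
  rcases eq_or_ne y a with rfl | hy
  · simp
  · have hprim : (y - a) • ∫ t in (0 : ℝ)..1, deriv h (a + (y - a) * t) = h y - h a := by
      rw [intervalIntegral.smul_integral_comp_add_mul, mul_zero, add_zero, mul_one,
        add_sub_cancel, intervalIntegral.integral_deriv_eq_sub
          (fun x _ => hh.differentiable one_ne_zero x)
          (hh.continuous_deriv_one.intervalIntegrable a y)]
    rw [dslope_of_ne h hy, slope_def_module, ← hprim, inv_smul_smul₀ (sub_ne_zero.2 hy)]

theorem contDiff_dslope (hh : ContDiff ℝ ∞ h) (a : ℝ) : ContDiff ℝ ∞ (dslope h a) := by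
  rw [funext (dslope_eq_integral_deriv (hh.of_le (mod_cast le_top)) a)]
  exact contDiff_parametric_intervalIntegral
    (F := fun q : ℝ × ℝ => deriv h (a + (q.1 - a) * q.2))
    ((contDiff_infty_deriv hh).comp (by fun_prop)) 0 1

theorem contDiff_sqDeriv (hh : ContDiff ℝ ∞ h) : ContDiff ℝ ∞ (sqDeriv h) :=
  (contDiff_dslope (contDiff_infty_deriv hh) 0).const_smul _

/-- **Whitney's theorem on even functions** -/
theorem exists_contDiff_comp_sq_of_even (hh : ContDiff ℝ ∞ h) (he : Function.Even h) :
    ∃ g : ℝ → E, ContDiff ℝ ∞ g ∧ ∀ y, h y = g (y ^ 2) := by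
  have hH : ∀ n, ContDiff ℝ ∞ (sqDeriv^[n] h) ∧ Function.Even (sqDeriv^[n] h) := fun n => by
    induction n with
    | zero => exact ⟨hh, he⟩
    | succ n ih =>
      rw [Function.iterate_succ_apply']
      exact ⟨contDiff_sqDeriv ih.1, even_sqDeriv ih.2⟩
  obtain ⟨g, hg, hgh⟩ := exists_contDiff_eqOn_Ici (f := fun n w => sqDeriv^[n] h √w)
    (fun n => ((hH n).1.continuous.comp Real.continuous_sqrt).continuousOn) fun n w hw => by
      rw [Function.iterate_succ_apply']
      exact hasDerivAt_comp_sqrt_of_even (hH n).1 (hH n).2 hw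
  refine ⟨g, hg, fun y => ?_⟩
  have hgy : g (y ^ 2) = h |y| := by rw [hgh (sq_nonneg y), ← Real.sqrt_sq_eq_abs]; rfl
  rw [hgy]
  rcases abs_choice y with hy | hy
  · rw [hy]
  · rw [hy, he]

theorem exists_contDiff_eventuallyEq_comp_sq (hh : ContDiff ℝ ∞ h)
    (he : ∀ᶠ y in 𝓝 0, h (-y) = h y) :
    ∃ g : ℝ → E, ContDiff ℝ ∞ g ∧ ∀ᶠ y in 𝓝 0, h y = g (y ^ 2) := by
  obtain ⟨g, hg, hgh⟩ := exists_contDiff_comp_sq_of_even (h := fun y => h y + h (-y))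
    (by fun_prop) (even_add_comp_neg h)
  refine ⟨fun w => (1 / 2 : ℝ) • g w, hg.const_smul _, he.mono fun y hy => ?_⟩
  beta_reduce
  rw [← hgh, hy, ← two_smul ℝ (h y), smul_smul, one_div_mul_cancel two_ne_zero, one_smul]

theorem exists_contDiff_even_odd_decomposition (hh : ContDiff ℝ ∞ h) :
    ∃ g₀ g₁ : ℝ → E, ContDiff ℝ ∞ g₀ ∧ ContDiff ℝ ∞ g₁ ∧ g₀ 0 = h 0 ∧ g₁ 0 = deriv h 0 ∧
      ∀ y, h y = g₀ (y ^ 2) + y • g₁ (y ^ 2) := by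
  obtain ⟨e, he, hev⟩ := exists_contDiff_comp_sq_of_even (h := fun y => h y + h (-y))
    (by fun_prop) (even_add_comp_neg h)
  have ho := odd_sub_comp_neg h
  obtain ⟨o, hoc, hodd⟩ := exists_contDiff_comp_sq_of_even (h := dslope (fun y => h y - h (-y)) 0)
    (contDiff_dslope (by fun_prop) 0) (even_dslope_of_odd ho)
  let g₀ : ℝ → E := fun w => (1 / 2 : ℝ) • e w
  let g₁ : ℝ → E := fun w => (1 / 2 : ℝ) • o w
  have hg₀ : ContDiff ℝ ∞ g₀ := he.const_smul _
  have hg₁ : ContDiff ℝ ∞ g₁ := hoc.const_smul _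
  have hsum : ∀ y, h y = g₀ (y ^ 2) + y • g₁ (y ^ 2) := fun y => by
    simp only [g₀, g₁]
    rw [← hev, ← hodd, smul_comm y, smul_dslope_of_odd ho, ← smul_add, add_add_sub_cancel,
      ← two_smul ℝ (h y), smul_smul, one_div_mul_cancel two_ne_zero, one_smul]
  refine ⟨g₀, g₁, hg₀, hg₁, by simpa using (hsum 0).symm, ?_, hsum⟩
  have hderiv : HasDerivAt (fun y : ℝ => g₀ (y ^ 2) + y • g₁ (y ^ 2)) (g₁ 0) 0 :=
    ((hasDerivAt_comp_sq hg₀ 0).add ((hasDerivAt_id 0).smul (hasDerivAt_comp_sq hg₁ 0))).congr_deriv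
      (by simp)
  rw [funext hsum, hderiv.deriv]

end Even

section InverseFunction

variable {X Y Z : Type*} [NormedAddCommGroup X] [NormedSpace ℝ X]
  [NormedAddCommGroup Y] [NormedSpace ℝ Y] [NormedAddCommGroup Z] [NormedSpace ℝ Z]

theorem fderiv_zero_apply_eq_of_hasDerivAt {F : X → Y} (hF : DifferentiableAt ℝ F 0) {x : X}
    {y : Y} (h : HasDerivAt (fun t : ℝ => F (t • x)) y 0) : fderiv ℝ F 0 x = y := by
  have hline : HasDerivAt (fun t : ℝ => t • x) x 0 := by
    simpa using (hasDerivAt_id (0 : ℝ)).smul_const x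
  rw [← zero_smul ℝ x] at hF
  have hcomp := hF.hasFDerivAt.comp_hasDerivAt (0 : ℝ) hline
  rw [zero_smul] at hcomp
  exact hcomp.unique h

theorem hasDerivAt_comp_mul_const {u : ℝ → Y} (hu : ContDiff ℝ ∞ u) (m : ℝ) :
    HasDerivAt (fun t : ℝ => u (t * m)) (m • deriv u 0) 0 := by
  have h := (hasDerivAt_of_contDiff_infty hu (0 * m)).scomp 0 (hasDerivAt_mul_const m)
  rwa [zero_mul] at h

theorem hasDerivAt_mul_const_smul_comp {u : ℝ → Y} (hu : ContDiff ℝ ∞ u) (r m : ℝ) :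
    HasDerivAt (fun t : ℝ => (t * r) • u (t * m)) (r • u 0) 0 :=
  ((hasDerivAt_mul_const r).smul (hasDerivAt_comp_mul_const hu m)).congr_deriv (by simp)

theorem exists_openPartialHomeomorph_of_hasFDerivAt [CompleteSpace X] {F : X → Y}
    (hF : ContDiff ℝ ∞ F) {a : X} (L : X ≃L[ℝ] Y) (hL : HasFDerivAt F (L : X →L[ℝ] Y) a) :
    ∃ e : OpenPartialHomeomorph X Y, ⇑e = F ∧ a ∈ e.source ∧ ContDiffOn ℝ ∞ e.symm e.target := by
  let e₀ := hF.contDiffAt.toOpenPartialHomeomorph F hL (by simp)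
  have ha : a ∈ e₀.source := hF.contDiffAt.mem_toOpenPartialHomeomorph_source hL (by simp)
  -- the inverse is smooth where the derivative of `F` is invertible, not only near one point
  let U : Set X := fderiv ℝ F ⁻¹' Set.range ((↑) : (X ≃L[ℝ] Y) → X →L[ℝ] Y)
  have hU : IsOpen U := ContinuousLinearEquiv.isOpen.preimage (hF.continuous_fderiv (by simp))
  refine ⟨e₀.restrOpen U hU, rfl, ⟨ha, L, hL.fderiv.symm⟩, fun y hy => ?_⟩
  obtain ⟨hy₀, L', hL'⟩ : y ∈ e₀.target ∧ e₀.symm y ∈ U := by simpa using hy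
  refine (e₀.contDiffAt_symm (f₀' := L') hy₀ ?_ hF.contDiffAt).contDiffWithinAt
  rw [hL']
  exact (hF.differentiable (by simp) _).hasFDerivAt

theorem exists_openPartialHomeomorph_of_injective_fderiv [FiniteDimensional ℝ X]
    [FiniteDimensional ℝ Y] (hdim : Module.finrank ℝ X = Module.finrank ℝ Y) {F : X → Y}
    (hF : ContDiff ℝ ∞ F) {a : X} (hinj : Function.Injective (fderiv ℝ F a)) :
    ∃ e : OpenPartialHomeomorph X Y, ⇑e = F ∧ a ∈ e.source ∧ ContDiffOn ℝ ∞ e.symm e.target := by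
  have : CompleteSpace X := FiniteDimensional.complete ℝ X
  let L := (LinearMap.linearEquivOfInjective (fderiv ℝ F a : X →ₗ[ℝ] Y) hinj
    hdim).toContinuousLinearEquiv
  exact exists_openPartialHomeomorph_of_hasFDerivAt hF L
    (hF.differentiable (by simp) a).hasFDerivAt

theorem exists_contDiff_eventuallyEq [FiniteDimensional ℝ X] {n : ℕ∞} {S : X → Y} {U : Set X}
    (hU : IsOpen U) (hS : ContDiffOn ℝ n S U) {a : X} (ha : a ∈ U) :
    ∃ R : X → Y, ContDiff ℝ n R ∧ R =ᶠ[𝓝 a] S := by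
  obtain ⟨r, hr, hrU⟩ := Metric.isOpen_iff.1 hU a ha
  let χ : ContDiffBump a := ⟨r / 4, r / 2, by positivity, by linarith⟩
  refine ⟨fun x => χ x • S x, contDiff_iff_contDiffAt.2 fun x => ?_, ?_⟩
  · by_cases hx : x ∈ tsupport fun x => χ x • S x
    · have hxball : x ∈ Metric.closedBall a (r / 2) := by
        rw [← χ.tsupport_eq]
        exact closure_mono (Function.support_smul_subset_left (χ : X → ℝ) S) hx
      have hxU : x ∈ U := hrU (Metric.closedBall_subset_ball (half_lt_self hr) hxball)
      exact χ.contDiff.contDiffAt.smul (hS.contDiffAt (hU.mem_nhds hxU))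
    · exact contDiffAt_const.congr_of_eventuallyEq (notMem_tsupport_iff_eventuallyEq.1 hx)
  · filter_upwards [χ.eventuallyEq_one] with x hx
    rw [hx, Pi.one_apply, one_smul]

theorem injective_fderiv_fst_prodMk {W : X × Z → Y} (hW : DifferentiableAt ℝ W 0)
    (hinj : ∀ z, fderiv ℝ W 0 (0, z) = 0 → z = 0) :
    Function.Injective (fderiv ℝ (fun q : X × Z => (q.1, W q)) 0) := by
  have hderiv : HasFDerivAt (fun q : X × Z => (q.1, W q))
      ((ContinuousLinearMap.fst ℝ X Z).prod (fderiv ℝ W 0)) 0 :=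
    hasFDerivAt_fst.prodMk hW.hasFDerivAt
  rw [hderiv.fderiv]
  refine (injective_iff_map_eq_zero _).2 ?_
  rintro ⟨x, z⟩ hxz
  obtain rfl : x = 0 := congrArg Prod.fst hxz
  rw [hinj z (congrArg Prod.snd hxz), Prod.mk_zero_zero]

variable [FiniteDimensional ℝ X] [FiniteDimensional ℝ Y] [FiniteDimensional ℝ Z]

theorem exists_contDiff_implicitFunction (hdim : Module.finrank ℝ Z = Module.finrank ℝ Y)
    {W : X × Z → Y} (hW : ContDiff ℝ ∞ W) (hW0 : W 0 = 0)
    (hinj : ∀ z, fderiv ℝ W 0 (0, z) = 0 → z = 0) :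
    ∃ S : X → Z, ContDiff ℝ ∞ S ∧ S 0 = 0 ∧ ∀ᶠ q in 𝓝 (0 : X × Z), W q = 0 ↔ q.2 = S q.1 := by
  obtain ⟨e, heF, he0, he_symm⟩ := exists_openPartialHomeomorph_of_injective_fderiv
    (by simp [hdim]) (contDiff_fst.prodMk hW)
    (injective_fderiv_fst_prodMk (hW.differentiable (by simp) 0) hinj)
  have heq : ∀ q, e q = (q.1, W q) := congrFun heF
  have he00 : e 0 = 0 := by rw [heq, hW0]; rfl
  have he_symm0 : e.symm 0 = 0 := by rw [← he00, e.left_inv he0]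
  let U : Set X := (fun x => ((x, 0) : X × Y)) ⁻¹' e.target
  have hU : IsOpen U := e.open_target.preimage (by fun_prop)
  have hU0 : ((0, 0) : X × Y) ∈ e.target := by
    have h := e.map_source he0
    rwa [he00] at h
  obtain ⟨S, hS, hSe⟩ := exists_contDiff_eventuallyEq hU (n := ⊤)
    (contDiff_snd.comp_contDiffOn (he_symm.comp (by fun_prop) fun x hx => hx)) hU0
  refine ⟨S, hS, ?_, ?_⟩
  · rw [hSe.self_of_nhds]
    exact congrArg Prod.snd he_symm0
  · have hfst : Tendsto Prod.fst (𝓝 (0 : X × Z)) (𝓝 0) := continuous_fst.tendsto 0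
    filter_upwards [e.open_source.mem_nhds he0, hfst.eventually hSe,
      hfst.eventually (hU.mem_nhds (show (0 : X) ∈ U from hU0))] with q hq hSq hqU
    rw [hSq]
    constructor
    · intro hWq
      have h := e.left_inv hq
      rw [heq, hWq] at h
      exact (congrArg Prod.snd h).symm
    · intro hq2
      have hfst : (e.symm (q.1, 0)).1 = q.1 := by
        simpa only [heq] using congrArg Prod.fst (e.right_inv hqU)
      have hq' : e.symm (q.1, 0) = q := Prod.ext hfst hq2.symm
      simpa only [hq', heq] using congrArg Prod.snd (e.right_inv hqU)

theorem exists_even_contDiff_implicitFunction (hdim : Module.finrank ℝ Z = Module.finrank ℝ Y)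
    {W : X × Z → Y} (hW : ContDiff ℝ ∞ W) (hW0 : W 0 = 0)
    (hinj : ∀ z, fderiv ℝ W 0 (0, z) = 0 → z = 0) (heven : ∀ x z, W (-x, z) = W (x, z)) :
    ∃ T : X → Z, ContDiff ℝ ∞ T ∧ Function.Even T ∧ T 0 = 0 ∧ ∀ᶠ x in 𝓝 0, W (x, T x) = 0 := by
  obtain ⟨S, hS, hS0, hWS⟩ := exists_contDiff_implicitFunction hdim hW hW0 hinj
  have hgraph : Tendsto (fun x => (x, S x)) (𝓝 0) (𝓝 (0 : X × Z)) := by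
    have h : Continuous fun x => (x, S x) := by fun_prop
    exact h.tendsto' 0 0 (by simp [hS0])
  have hgraph_neg : Tendsto (fun x => (-x, S x)) (𝓝 0) (𝓝 (0 : X × Z)) := by
    have h : Continuous fun x => (-x, S x) := by fun_prop
    exact h.tendsto' 0 0 (by simp [hS0])
  have hsolution : ∀ᶠ x in 𝓝 0, W (x, S x) = 0 := (hgraph.eventually hWS).mono fun x hx => hx.2 rfl
  -- uniqueness of the implicit function makes it even
  have hSeven : ∀ᶠ x in 𝓝 0, S x = S (-x) := by
    filter_upwards [hsolution, hgraph_neg.eventually hWS] with x hx hx'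
    exact hx'.1 ((heven x (S x)).trans hx)
  refine ⟨fun x => (1 / 2 : ℝ) • (S x + S (-x)), by fun_prop,
    fun x => congrArg _ (even_add_comp_neg S x), by simp [hS0], ?_⟩
  filter_upwards [hsolution, hSeven] with x hx hx'
  rwa [← hx', ← two_smul ℝ (S x), smul_smul, one_div_mul_cancel two_ne_zero, one_smul]

end InverseFunction

theorem eq_zero_of_linearIndependent {R M : Type*} [Ring R] [AddCommGroup M] [Module R M]
    {x y z : M} (h : LinearIndependent R ![x, y, z]) {a b c : R}
    (hsum : a • x + b • y + c • z = 0) : a = 0 ∧ b = 0 ∧ c = 0 := by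
  have hcoeff := Fintype.linearIndependent_iff.1 h ![a, b, c]
    (by simpa [Fin.sum_univ_three] using hsum)
  exact ⟨hcoeff 0, hcoeff 1, hcoeff 2⟩

theorem linearIndependent_of_smul_eq {K V : Type*} [Field K] [AddCommGroup V] [Module K V]
    {x y z w : V} {a b c : K} (hc : c ≠ 0) (h : LinearIndependent K ![x, y, z])
    (hw : c • w = z + a • x + b • y) : LinearIndependent K ![x, y, w] := by
  refine Fintype.linearIndependent_iff.2 fun r hr => ?_
  simp only [Fin.sum_univ_three, Matrix.cons_val] at hr
  have hsum : (c * r 0 + r 2 * a) • x + (c * r 1 + r 2 * b) • y + r 2 • z = 0 := by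
    rw [← smul_zero (M := K) (A := V) c, ← hr, smul_add c _ (r 2 • w), smul_comm c (r 2) w, hw]
    module
  obtain ⟨h0, h1, h2⟩ := eq_zero_of_linearIndependent h hsum
  simp only [h2, zero_mul, add_zero, mul_eq_zero, hc, false_or] at h0 h1
  intro i
  fin_cases i <;> assumption

section DoublePoints

variable {E : Type*} [NormedAddCommGroup E] [NormedSpace ℝ E] {β γ ξ : ℝ → E}

/-- The mean value of `g` on the interval with centre `q.1` and radius `q.2`, a smooth function of
both also where the radius vanishes. -/
def centralMean (g : ℝ → E) (q : ℝ × ℝ) : E :=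
  (1 / 2 : ℝ) • ∫ t in (-1 : ℝ)..1, g (q.1 + q.2 * t)

theorem contDiff_centralMean {g : ℝ → E} (hg : ContDiff ℝ ∞ g) : ContDiff ℝ ∞ (centralMean g) :=
  (contDiff_parametric_intervalIntegral
    (F := fun q : (ℝ × ℝ) × ℝ => g (q.1.1 + q.1.2 * q.2)) (by fun_prop) (-1) 1).const_smul _

theorem centralMean_neg_right (g : ℝ → E) (m y : ℝ) :
    centralMean g (m, -y) = centralMean g (m, y) := by
  have h := intervalIntegral.integral_comp_neg (a := -1) (b := 1) fun t => g (m + y * t)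
  simp only [neg_neg, mul_neg] at h
  simp only [centralMean, neg_mul, h]

/-- The difference, divided by `2 y`, of the points with parameters `(p + y q, m + y)` and
`(p - y q, m - y)` of the ruled surface `(u, v) ↦ γ v + u • ξ v`, where `γ' v = v • β v`, as a
function of `(y, m, p, q)`. For `y ≠ 0` its zeros are double points of the surface. -/
def doublePointDefect (β ξ : ℝ → E) (z : ℝ × ℝ × ℝ × ℝ) : E :=
  centralMean (fun t => t • β t) (z.2.1, z.1) + z.2.2.1 • centralMean (deriv ξ) (z.2.1, z.1) +
    z.2.2.2 • (1 / 2 : ℝ) • (ξ (z.2.1 + z.1) + ξ (z.2.1 - z.1))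

theorem contDiff_doublePointDefect (hβ : ContDiff ℝ ∞ β) (hξ : ContDiff ℝ ∞ ξ) :
    ContDiff ℝ ∞ (doublePointDefect β ξ) := by
  have hmean := contDiff_centralMean (contDiff_id.smul hβ)
  have hmean' := contDiff_centralMean (contDiff_infty_deriv hξ)
  unfold doublePointDefect
  fun_prop

theorem doublePointDefect_neg (β ξ : ℝ → E) (y : ℝ) (τ : ℝ × ℝ × ℝ) :
    doublePointDefect β ξ (-y, τ) = doublePointDefect β ξ (y, τ) := by
  simp only [doublePointDefect, centralMean_neg_right, sub_neg_eq_add, ← sub_eq_add_neg,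
    add_comm (ξ (τ.1 - y))]

variable [CompleteSpace E]

theorem centralMean_zero_right (g : ℝ → E) (m : ℝ) : centralMean g (m, 0) = g m := by
  simp only [centralMean, zero_mul, add_zero, intervalIntegral.integral_const, smul_smul]
  norm_num

theorem smul_centralMean {g h : ℝ → E} (hg : Continuous g) (hh : ∀ v, HasDerivAt h (g v) v)
    (m y : ℝ) : (2 * y) • centralMean g (m, y) = h (m + y) - h (m - y) := by
  have hsubst := intervalIntegral.smul_integral_comp_add_mul (a := -1) (b := 1) g y m
  rw [intervalIntegral.integral_eq_sub_of_hasDerivAt (fun x _ => hh x)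
    (hg.intervalIntegrable _ _), mul_one, mul_neg_one, ← sub_eq_add_neg] at hsubst
  rw [centralMean, smul_smul, mul_right_comm, mul_one_div_cancel two_ne_zero, one_mul, hsubst]

theorem doublePointDefect_zero_left (β ξ : ℝ → E) (m p q : ℝ) :
    doublePointDefect β ξ (0, m, p, q) = m • β m + p • deriv ξ m + q • ξ m := by
  simp only [doublePointDefect, centralMean_zero_right, add_zero, sub_zero]
  rw [← two_smul ℝ (ξ m), smul_smul (1 / 2 : ℝ), one_div_mul_cancel two_ne_zero, one_smul]

theorem fderiv_doublePointDefect_zero (hβ : ContDiff ℝ ∞ β) (hξ : ContDiff ℝ ∞ ξ) (m p q : ℝ) :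
    fderiv ℝ (doublePointDefect β ξ) 0 (0, m, p, q) = m • β 0 + p • deriv ξ 0 + q • ξ 0 := by
  refine fderiv_zero_apply_eq_of_hasDerivAt
    ((contDiff_doublePointDefect hβ hξ).differentiable (by simp) 0) ?_
  simp only [Prod.smul_mk, smul_eq_mul, mul_zero, doublePointDefect_zero_left]
  exact ((hasDerivAt_mul_const_smul_comp hβ m m).add
    (hasDerivAt_mul_const_smul_comp (contDiff_infty_deriv hξ) p m)).add
      (hasDerivAt_mul_const_smul_comp hξ q m)

theorem smul_doublePointDefect (hβ : Continuous β) (hξ : ContDiff ℝ ∞ ξ)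
    (hγ' : ∀ v, HasDerivAt γ (v • β v) v) (y m p q : ℝ) :
    (2 * y) • doublePointDefect β ξ (y, m, p, q) =
      (γ (m + y) + (p + y * q) • ξ (m + y)) - (γ (m - y) + (p - y * q) • ξ (m - y)) := by
  have hγmean := smul_centralMean (g := fun t => t • β t) (by fun_prop) hγ' m y
  have hξmean := smul_centralMean (contDiff_infty_deriv hξ).continuous
    (hasDerivAt_of_contDiff_infty hξ) m y
  simp only [doublePointDefect, smul_add, smul_comm (2 * y) p, hγmean, hξmean]
  module

end DoublePoints

section RuledSurface

variable {E : Type*} [NormedAddCommGroup E] [NormedSpace ℝ E] {β γ ξ : ℝ → E} {s v : ℝ → ℝ}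

theorem exists_doublePointCurve [FiniteDimensional ℝ E] (hdim : Module.finrank ℝ E = 3)
    (hξ : ContDiff ℝ ∞ ξ) (hβ : ContDiff ℝ ∞ β) (hγ' : ∀ v, HasDerivAt γ (v • β v) v)
    (hli : LinearIndependent ℝ ![ξ 0, deriv ξ 0, β 0]) :
    ∃ v s : ℝ → ℝ, ContDiff ℝ ∞ v ∧ ContDiff ℝ ∞ s ∧ v 0 = 0 ∧ deriv v 0 = 1 ∧ s 0 = 0 ∧
      ∀ᶠ y in 𝓝 0, γ (v (-y)) + s (-y) • ξ (v (-y)) = γ (v y) + s y • ξ (v y) := by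
  have : CompleteSpace E := FiniteDimensional.complete ℝ E
  have hinj : ∀ τ, fderiv ℝ (doublePointDefect β ξ) 0 (0, τ) = 0 → τ = 0 := by
    rintro ⟨m, p, q⟩ hτ
    rw [fderiv_doublePointDefect_zero hβ hξ, add_assoc, add_comm, add_comm (p • _)] at hτ
    obtain ⟨rfl, rfl, rfl⟩ := eq_zero_of_linearIndependent hli hτ
    rfl
  have hdefect0 : doublePointDefect β ξ 0 = 0 :=
    (doublePointDefect_zero_left β ξ 0 0 0).trans (by simp)
  obtain ⟨T, hT, hTeven, hT0, hTdefect⟩ := exists_even_contDiff_implicitFunction (by simp [hdim])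
    (contDiff_doublePointDefect hβ hξ) hdefect0 hinj (doublePointDefect_neg β ξ)
  have hm : ContDiff ℝ ∞ fun y => (T y).1 := by fun_prop
  have hm' : deriv (fun y => (T y).1) 0 = 0 :=
    apply_zero_of_odd (odd_deriv_of_even fun y => congrArg Prod.fst (hTeven y))
  refine ⟨fun y => (T y).1 + y, fun y => (T y).2.1 + y * (T y).2.2, by fun_prop, by fun_prop,
    by simp [hT0], ?_, by simp [hT0], ?_⟩
  · have h := (hasDerivAt_of_contDiff_infty hm 0).add (hasDerivAt_id 0)
    rw [hm', zero_add] at h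
    exact h.deriv
  · filter_upwards [hTdefect] with y hy
    have h := smul_doublePointDefect hβ.continuous hξ hγ' y (T y).1 (T y).2.1 (T y).2.2
    rw [hy, smul_zero, eq_comm, sub_eq_zero] at h
    simp only [hTeven y, ← sub_eq_add_neg, neg_mul]
    exact h.symm

theorem deriv_deriv_ruled_curve (hξ : ContDiff ℝ ∞ ξ) (hβ : ContDiff ℝ ∞ β)
    (hγ' : ∀ v, HasDerivAt γ (v • β v) v) (hv : ContDiff ℝ ∞ v) (hs : ContDiff ℝ ∞ s)
    (hv0 : v 0 = 0) (hv1 : deriv v 0 = 1) (hs0 : s 0 = 0) :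
    deriv (deriv fun y => γ (v y) + s y • ξ (v y)) 0 =
      β 0 + deriv (deriv s) 0 • ξ 0 + (2 * deriv s 0) • deriv ξ 0 := by
  have hvd := hasDerivAt_of_contDiff_infty hv
  have hsd := hasDerivAt_of_contDiff_infty hs
  have hcomp : ∀ {u : ℝ → E}, ContDiff ℝ ∞ u →
      ∀ y, HasDerivAt (fun y => u (v y)) (deriv v y • deriv u (v y)) y := fun hu y =>
    (hasDerivAt_of_contDiff_infty hu (v y)).scomp y (hvd y)
  have hderiv : (deriv fun y => γ (v y) + s y • ξ (v y)) = fun y =>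
      deriv v y • v y • β (v y) + (s y • deriv v y • deriv ξ (v y) + deriv s y • ξ (v y)) :=
    funext fun y =>
      (((hγ' (v y)).scomp y (hvd y)).add ((hsd y).smul (hcomp hξ y))).deriv
  have hv'd := hasDerivAt_of_contDiff_infty (contDiff_infty_deriv hv) 0
  have hs'd := hasDerivAt_of_contDiff_infty (contDiff_infty_deriv hs) 0
  have hderiv' := (hv'd.smul ((hvd 0).smul (hcomp hβ 0))).add
    (((hsd 0).smul (hv'd.smul (hcomp (contDiff_infty_deriv hξ) 0))).add (hs'd.smul (hcomp hξ 0)))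
  rw [hderiv]
  refine hderiv'.deriv.trans ?_
  simp only [Pi.smul_apply', hv0, hv1, hs0]
  module

end RuledSurface

section NormalForm

theorem contDiff_fStd : ContDiff ℝ ∞ fStd := by
  refine contDiff_euclidean.2 fun i => ?_
  fin_cases i <;> simp only [fStd, Fin.zero_eta, Fin.mk_one, Fin.reduceFinMk, Matrix.cons_val] <;>
    fun_prop

theorem fStd_zero : fStd 0 = 0 := by
  ext i
  fin_cases i <;> simp [fStd]

theorem isCrossCapAt_of_comp_eq {f : ℝ × ℝ → E3} {κ : ℝ × ℝ → ℝ × ℝ} {Ψ : E3 → E3}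
    (hκ : ContDiff ℝ ∞ κ) (hκinj : Function.Injective (fderiv ℝ κ 0)) (hΨ : ContDiff ℝ ∞ Ψ)
    (hΨinj : Function.Injective (fderiv ℝ Ψ 0)) (hf : ∀ᶠ p in 𝓝 0, f (κ p) = Ψ (fStd p)) :
    IsCrossCapAt f (κ 0) := by
  obtain ⟨eκ, heκ, heκ0, heκ_symm⟩ :=
    exists_openPartialHomeomorph_of_injective_fderiv rfl hκ hκinj
  obtain ⟨eΨ, heΨ, heΨ0, heΨ_symm⟩ :=
    exists_openPartialHomeomorph_of_injective_fderiv rfl hΨ hΨinj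
  obtain ⟨O, hO, hO_open, hO0⟩ := eventually_nhds_iff.1 hf
  let V : Set (ℝ × ℝ) := O ∩ fStd ⁻¹' eΨ.source
  have hV : IsOpen V := hO_open.inter (eΨ.open_source.preimage contDiff_fStd.continuous)
  have hV0 : (0 : ℝ × ℝ) ∈ V := ⟨hO0, by rwa [mem_preimage, fStd_zero]⟩
  let e := eκ.restrOpen V hV
  have he : ⇑e = κ := heκ
  have he0 : (0 : ℝ × ℝ) ∈ e.source := ⟨heκ0, hV0⟩
  have hfΨ : ∀ p ∈ V, f (κ p) = eΨ (fStd p) := fun p hp => (hO p hp.1).trans (by rw [heΨ])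
  have hsymm : ∀ q ∈ e.target, e.symm q ∈ V ∧ f q = eΨ (fStd (e.symm q)) := fun q hq => by
    have hqV : e.symm q ∈ V := (e.map_target hq).2
    exact ⟨hqV, by rw [← hfΨ _ hqV, ← he, e.right_inv hq]⟩
  have hf0 : f (κ 0) = eΨ 0 := by rw [hfΨ 0 hV0, fStd_zero]
  refine ⟨e.symm, eΨ.symm, heκ_symm.mono fun q hq => hq.1, ?_, heΨ_symm, ?_, ?_, ?_, ?_, ?_,
    fun q hq => ?_, fun q hq => ?_⟩
  · exact hκ.contDiffOn.congr fun p _ => congrFun he p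
  · exact hΨ.contDiffOn.congr fun p _ => congrFun heΨ p
  · exact he ▸ e.map_source he0
  · exact he ▸ e.left_inv he0
  · exact hf0 ▸ eΨ.map_source heΨ0
  · exact hf0 ▸ eΨ.left_inv heΨ0
  · exact (hsymm q hq).2 ▸ eΨ.map_source (hsymm q hq).1.2
  · exact (hsymm q hq).2 ▸ eΨ.left_inv (hsymm q hq).1.2

theorem injective_fderiv_shear_zero {s v : ℝ → ℝ} (hs : ContDiff ℝ ∞ s) (hv : ContDiff ℝ ∞ v)
    (hv1 : deriv v 0 ≠ 0) :
    Function.Injective (fderiv ℝ (fun p : ℝ × ℝ => (s p.2 + p.1, v p.2)) 0) := by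
  refine (injective_iff_map_eq_zero _).2 fun z hz => ?_
  have hderiv : fderiv ℝ (fun p : ℝ × ℝ => (s p.2 + p.1, v p.2)) 0 z =
      (z.2 • deriv s 0 + z.1, z.2 • deriv v 0) := by
    refine fderiv_zero_apply_eq_of_hasDerivAt ?_
      (((hasDerivAt_comp_mul_const hs z.2).add (hasDerivAt_mul_const z.1)).prodMk
        (hasDerivAt_comp_mul_const hv z.2))
    have hκ : ContDiff ℝ ∞ fun p : ℝ × ℝ => (s p.2 + p.1, v p.2) := by fun_prop
    exact hκ.differentiable (by simp) 0
  rw [hderiv] at hz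
  have h2 : z.2 = 0 := (smul_eq_zero.1 (congrArg Prod.snd hz)).resolve_right hv1
  have h1 : z.1 = 0 := by simpa [h2] using congrArg Prod.fst hz
  exact Prod.ext h1 h2

variable {E : Type*} [NormedAddCommGroup E] [NormedSpace ℝ E] {A P Q : ℝ → E}

/-- The map of space whose composite with the standard cross cap is
`(x, y) ↦ A (y²) + x • (P (y²) + y • Q (y²))`. -/
def crossCapLift (A P Q : ℝ → E) (z : E3) : E :=
  A (z 2) + z 0 • P (z 2) + z 1 • Q (z 2)

theorem contDiff_crossCapLift (hA : ContDiff ℝ ∞ A) (hP : ContDiff ℝ ∞ P)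
    (hQ : ContDiff ℝ ∞ Q) : ContDiff ℝ ∞ (crossCapLift A P Q) := by
  unfold crossCapLift
  fun_prop

theorem crossCapLift_fStd (A P Q : ℝ → E) (p : ℝ × ℝ) :
    crossCapLift A P Q (fStd p) = A (p.2 ^ 2) + p.1 • (P (p.2 ^ 2) + p.2 • Q (p.2 ^ 2)) := by
  simp only [crossCapLift, fStd, Matrix.cons_val]
  module

theorem injective_fderiv_crossCapLift_zero (hA : ContDiff ℝ ∞ A) (hP : ContDiff ℝ ∞ P)
    (hQ : ContDiff ℝ ∞ Q) (hli : LinearIndependent ℝ ![P 0, Q 0, deriv A 0]) :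
    Function.Injective (fderiv ℝ (crossCapLift A P Q) 0) := by
  refine (injective_iff_map_eq_zero _).2 fun z hz => ?_
  have hderiv : fderiv ℝ (crossCapLift A P Q) 0 z = z 2 • deriv A 0 + z 0 • P 0 + z 1 • Q 0 :=
    fderiv_zero_apply_eq_of_hasDerivAt
      ((contDiff_crossCapLift hA hP hQ).differentiable (by simp) 0)
      (((hasDerivAt_comp_mul_const hA (z 2)).add
        (hasDerivAt_mul_const_smul_comp hP (z 0) (z 2))).add
        (hasDerivAt_mul_const_smul_comp hQ (z 1) (z 2)))
  rw [hderiv, add_assoc, add_comm] at hz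
  obtain ⟨h0, h1, h2⟩ := eq_zero_of_linearIndependent hli hz
  ext i
  fin_cases i <;> assumption

theorem isCrossCapAt_ruled {β γ ξ : ℝ → E3} (hξ : ContDiff ℝ ∞ ξ) (hβ : ContDiff ℝ ∞ β)
    (hγ : ContDiff ℝ ∞ γ) (hγ' : ∀ v, HasDerivAt γ (v • β v) v)
    (hli : LinearIndependent ℝ ![ξ 0, deriv ξ 0, β 0]) :
    IsCrossCapAt (fun p => γ p.2 + p.1 • ξ p.2) 0 := by
  obtain ⟨v, s, hv, hs, hv0, hv1, hs0, hdouble⟩ :=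
    exists_doublePointCurve (by simp) hξ hβ hγ' hli
  obtain ⟨A, hA, hKA⟩ := exists_contDiff_eventuallyEq_comp_sq
    (h := fun y => γ (v y) + s y • ξ (v y)) (by fun_prop) hdouble
  obtain ⟨P, Q, hP, hQ, hP0, hQ0, hξv⟩ := exists_contDiff_even_odd_decomposition
    (h := fun y => ξ (v y)) (by fun_prop)
  have hQ0' : Q 0 = deriv ξ 0 := by
    have h := ((hasDerivAt_of_contDiff_infty hξ (v 0)).scomp 0
      (hasDerivAt_of_contDiff_infty hv 0)).deriv
    rw [hv1, hv0, one_smul] at h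
    exact hQ0.trans h
  have hA1 : (2 : ℝ) • deriv A 0 =
      β 0 + deriv (deriv s) 0 • ξ 0 + (2 * deriv s 0) • deriv ξ 0 := by
    have hKA' : deriv (fun y => γ (v y) + s y • ξ (v y)) =ᶠ[𝓝 0] deriv fun y => A (y ^ 2) :=
      EventuallyEq.deriv hKA
    rw [← deriv_deriv_comp_sq_zero hA, ← hKA'.deriv_eq]
    exact deriv_deriv_ruled_curve hξ hβ hγ' hv hs hv0 hv1 hs0
  have hliΨ : LinearIndependent ℝ ![P 0, Q 0, deriv A 0] := by
    rw [hP0, hQ0', hv0]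
    exact linearIndependent_of_smul_eq two_ne_zero hli hA1
  have hcross := isCrossCapAt_of_comp_eq (f := fun p => γ p.2 + p.1 • ξ p.2)
    (by fun_prop) (injective_fderiv_shear_zero hs hv (by simp [hv1]))
    (contDiff_crossCapLift hA hP hQ) (injective_fderiv_crossCapLift_zero hA hP hQ hliΨ) (by
      filter_upwards [continuous_snd.tendsto (0 : ℝ × ℝ) hKA] with p hp
      rw [crossCapLift_fStd, ← hξv, ← hp, add_smul, add_assoc])
  simpa [hv0, hs0, ← Prod.zero_eq_mk] using hcross

end NormalForm

section CrossProduct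

theorem inner_eq_dotProduct {ι : Type*} [Fintype ι] (x y : EuclideanSpace ℝ ι) :
    inner ℝ x y = x.ofLp ⬝ᵥ y.ofLp := by
  rw [EuclideanSpace.inner_eq_star_dotProduct, star_trivial, dotProduct_comm]

theorem inner_left_cross (x y : E3) : inner ℝ x (cross x y) = 0 := by
  rw [inner_eq_dotProduct]
  exact dot_self_cross _ _

theorem inner_right_cross (x y : E3) : inner ℝ y (cross x y) = 0 := by
  rw [inner_eq_dotProduct]
  exact dot_cross_self _ _

theorem inner_cross_cross (w x y z : E3) : inner ℝ (cross w x) (cross y z) =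
    inner ℝ w y * inner ℝ x z - inner ℝ w z * inner ℝ x y := by
  simp only [inner_eq_dotProduct]
  exact cross_dot_cross _ _ _ _

theorem inner_cross_eq_det (x y z : E3) : inner ℝ x (cross y z) =
    (EuclideanSpace.basisFun (Fin 3) ℝ).toBasis.det ![x, y, z] := by
  rw [inner_eq_dotProduct, Module.Basis.det_apply, ← Matrix.det_transpose]
  refine (triple_product_eq_det _ _ _).trans (congrArg _ ?_)
  ext i j
  fin_cases i <;> rfl

theorem cross_map (A : E3 ≃ₗᵢ[ℝ] E3) (x y : E3) : cross (A x) (A y) =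
    LinearMap.det (A.toLinearEquiv : E3 →ₗ[ℝ] E3) • A (cross x y) := by
  refine ext_inner_left ℝ fun w => ?_
  obtain ⟨z, rfl⟩ := A.surjective w
  rw [inner_smul_right, A.inner_map_map, inner_cross_eq_det, inner_cross_eq_det,
    ← Module.Basis.det_comp]
  congr 1
  funext i
  fin_cases i <;> rfl

theorem contDiff_cross {X : Type*} [NormedAddCommGroup X] [NormedSpace ℝ X] {n : WithTop ℕ∞}
    {f g : X → E3} (hf : ContDiff ℝ n f) (hg : ContDiff ℝ n g) :
    ContDiff ℝ n fun x => cross (f x) (g x) := by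
  refine contDiff_euclidean.2 fun i => ?_
  simp only [cross, cross_apply]
  fin_cases i <;> simp only [Fin.zero_eta, Fin.mk_one, Fin.reduceFinMk, Matrix.cons_val] <;>
    fun_prop

theorem hasDerivAt_map {E F : Type*} [NormedAddCommGroup E] [NormedSpace ℝ E]
    [NormedAddCommGroup F] [NormedSpace ℝ F] (A : E ≃ₗᵢ[ℝ] F) {f : ℝ → E} {f' : E} {x : ℝ}
    (hf : HasDerivAt f f' x) : HasDerivAt (fun x => A (f x)) (A f') x :=
  A.toContinuousLinearEquiv.toContinuousLinearMap.hasFDerivAt.comp_hasDerivAt x hf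

end CrossProduct

section SphericalCurve

variable {a₁₁ a₀₂ : ℝ} {c c₁ c₂ : ℝ → E3}

theorem isOpen_arcInterval : IsOpen arcInterval := isOpen_Ioo

theorem arctan_mem_arcInterval (x : ℝ) : Real.arctan x ∈ arcInterval := Real.arctan_mem_Ioo x

theorem IsSphericalCurve.hasDerivAt (hc : IsSphericalCurve c) {s : ℝ} (hs : s ∈ arcInterval) :
    HasDerivAt c (deriv c s) s :=
  ((hc.smooth.contDiffAt (isOpen_arcInterval.mem_nhds hs)).differentiableAt
    (by simp)).hasDerivAt

theorem IsSphericalCurve.inner_self (hc : IsSphericalCurve c) {s : ℝ} (hs : s ∈ arcInterval) :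
    inner ℝ (c s) (c s) = 1 := by
  rw [real_inner_self_eq_norm_sq, mem_sphere_zero_iff_norm.1 (hc.mem_sphere s hs), one_pow]

theorem IsSphericalCurve.inner_deriv_deriv (hc : IsSphericalCurve c) {s : ℝ}
    (hs : s ∈ arcInterval) : inner ℝ (deriv c s) (deriv c s) = 1 := by
  rw [real_inner_self_eq_norm_sq, hc.unit_speed s hs, one_pow]

theorem IsSphericalCurve.inner_deriv (hc : IsSphericalCurve c) {s : ℝ} (hs : s ∈ arcInterval) :
    inner ℝ (c s) (deriv c s) = 0 := by
  have hderiv := (hc.hasDerivAt hs).inner ℝ (hc.hasDerivAt hs)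
  have hconst : (fun t => inner ℝ (c t) (c t)) =ᶠ[𝓝 s] fun _ => (1 : ℝ) := by
    filter_upwards [isOpen_arcInterval.mem_nhds hs] with t ht using hc.inner_self ht
  have hzero := hderiv.unique ((hasDerivAt_const s (1 : ℝ)).congr_of_eventuallyEq hconst)
  rw [real_inner_comm (c s)] at hzero
  linarith

theorem one_add_sq_pos (a : ℝ) : 0 < 1 + a ^ 2 := by positivity

theorem one_add_mul_sq_pos (a v : ℝ) : 0 < 1 + (1 + a ^ 2) * v ^ 2 := by positivity

theorem contDiff_sqrt_one_add (a : ℝ) : ContDiff ℝ ∞ fun v : ℝ => √(1 + (1 + a ^ 2) * v ^ 2) :=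
  ContDiff.sqrt (by fun_prop) fun v => (one_add_mul_sq_pos a v).ne'

theorem contDiff_cHat (hc : ContDiffOn ℝ ∞ c arcInterval) : ContDiff ℝ ∞ (cHat a₁₁ c) := by
  have h : ContDiff ℝ ∞ fun v : ℝ => Real.arctan (v * √(1 + a₁₁ ^ 2)) :=
    Real.contDiff_arctan.comp (by fun_prop)
  rw [← contDiffOn_univ] at h ⊢
  exact hc.comp h fun v _ => arctan_mem_arcInterval _

theorem contDiff_xi (hc : ContDiffOn ℝ ∞ c arcInterval) : ContDiff ℝ ∞ (xi a₁₁ c) :=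
  (contDiff_sqrt_one_add a₁₁).smul (contDiff_cHat hc)

theorem contDiff_B (hc : ContDiffOn ℝ ∞ c arcInterval) : ContDiff ℝ ∞ (B a₁₁ c) :=
  have hξ' := contDiff_infty_deriv (contDiff_xi (a₁₁ := a₁₁) hc)
  (hξ'.const_smul a₁₁).add (contDiff_cross (contDiff_xi hc) hξ')

theorem hasDerivAt_xi (hc : IsSphericalCurve c) (v : ℝ) : HasDerivAt (xi a₁₁ c)
    ((√(1 + a₁₁ ^ 2) / √(1 + (1 + a₁₁ ^ 2) * v ^ 2)) •
      deriv c (Real.arctan (v * √(1 + a₁₁ ^ 2))) +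
      ((1 + a₁₁ ^ 2) * v / √(1 + (1 + a₁₁ ^ 2) * v ^ 2)) • cHat a₁₁ c v) v := by
  have hpos := one_add_mul_sq_pos a₁₁ v
  have hk : √(1 + a₁₁ ^ 2) ^ 2 = 1 + a₁₁ ^ 2 := Real.sq_sqrt (by positivity)
  have hr : √(1 + (1 + a₁₁ ^ 2) * v ^ 2) ^ 2 = 1 + v ^ 2 * (1 + a₁₁ ^ 2) := by
    rw [Real.sq_sqrt hpos.le, mul_comm (v ^ 2)]
  have hr0 : √(1 + (1 + a₁₁ ^ 2) * v ^ 2) ≠ 0 := (Real.sqrt_pos.2 hpos).ne'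
  have hcHat : HasDerivAt (cHat a₁₁ c) _ v :=
    (hc.hasDerivAt (arctan_mem_arcInterval (v * √(1 + a₁₁ ^ 2)))).scomp v
      (hasDerivAt_mul_const √(1 + a₁₁ ^ 2)).arctan
  have hradicand : HasDerivAt (fun v : ℝ => 1 + (1 + a₁₁ ^ 2) * v ^ 2)
      ((1 + a₁₁ ^ 2) * (2 * v)) v := by
    simpa using ((hasDerivAt_pow 2 v).const_mul (1 + a₁₁ ^ 2)).const_add 1
  refine ((hradicand.sqrt hpos.ne').smul hcHat).congr_deriv ?_
  rw [smul_smul, mul_pow, hk, ← hr]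
  congr 2 <;> field_simp

theorem inner_xi_xi (hc : IsSphericalCurve c) (v : ℝ) :
    inner ℝ (xi a₁₁ c v) (xi a₁₁ c v) = 1 + (1 + a₁₁ ^ 2) * v ^ 2 := by
  rw [xi, real_inner_smul_left, real_inner_smul_right, cHat,
    hc.inner_self (arctan_mem_arcInterval _), mul_one,
    Real.mul_self_sqrt (one_add_mul_sq_pos a₁₁ v).le]

theorem inner_xi_deriv_xi (hc : IsSphericalCurve c) (v : ℝ) :
    inner ℝ (xi a₁₁ c v) (deriv (xi a₁₁ c) v) = (1 + a₁₁ ^ 2) * v := by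
  have hr0 := (Real.sqrt_pos.2 (one_add_mul_sq_pos a₁₁ v)).ne'
  rw [(hasDerivAt_xi hc v).deriv, xi, inner_add_right]
  simp only [real_inner_smul_left, real_inner_smul_right, cHat,
    hc.inner_self (arctan_mem_arcInterval _), hc.inner_deriv (arctan_mem_arcInterval _)]
  field_simp
  ring

theorem inner_deriv_xi_deriv_xi (hc : IsSphericalCurve c) (v : ℝ) :
    inner ℝ (deriv (xi a₁₁ c) v) (deriv (xi a₁₁ c) v) = 1 + a₁₁ ^ 2 := by
  have hpos := one_add_mul_sq_pos a₁₁ v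
  have hr0 := (Real.sqrt_pos.2 hpos).ne'
  have hk : √(1 + a₁₁ ^ 2) ^ 2 = 1 + a₁₁ ^ 2 := Real.sq_sqrt (by positivity)
  have hr : √(1 + (1 + a₁₁ ^ 2) * v ^ 2) ^ 2 = 1 + (1 + a₁₁ ^ 2) * v ^ 2 := Real.sq_sqrt hpos.le
  rw [(hasDerivAt_xi hc v).deriv]
  simp only [inner_add_right, inner_add_left, real_inner_smul_left, real_inner_smul_right, cHat,
    hc.inner_self (arctan_mem_arcInterval _), hc.inner_deriv (arctan_mem_arcInterval _),
    hc.inner_deriv_deriv (arctan_mem_arcInterval _), real_inner_comm (c _) (deriv c _)]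
  field_simp
  rw [hr]
  linear_combination hk

theorem inner_cross_xi (hc : IsSphericalCurve c) (v : ℝ) :
    inner ℝ (cross (xi a₁₁ c v) (deriv (xi a₁₁ c) v)) (cross (xi a₁₁ c v) (deriv (xi a₁₁ c) v)) =
      1 + a₁₁ ^ 2 := by
  rw [inner_cross_cross, inner_xi_xi hc, real_inner_comm (xi a₁₁ c v), inner_xi_deriv_xi hc,
    inner_deriv_xi_deriv_xi hc]
  ring

theorem inner_xi_B (hc : IsSphericalCurve c) (v : ℝ) :
    inner ℝ (xi a₁₁ c v) (B a₁₁ c v) = a₁₁ * ((1 + a₁₁ ^ 2) * v) := by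
  rw [B, inner_add_right, real_inner_smul_right, inner_xi_deriv_xi hc, inner_left_cross, add_zero]

theorem inner_deriv_xi_B (hc : IsSphericalCurve c) (v : ℝ) :
    inner ℝ (deriv (xi a₁₁ c) v) (B a₁₁ c v) = a₁₁ * (1 + a₁₁ ^ 2) := by
  rw [B, inner_add_right, real_inner_smul_right, inner_deriv_xi_deriv_xi hc, inner_right_cross,
    add_zero]

theorem inner_cross_xi_B (hc : IsSphericalCurve c) (v : ℝ) :
    inner ℝ (cross (xi a₁₁ c v) (deriv (xi a₁₁ c) v)) (B a₁₁ c v) = 1 + a₁₁ ^ 2 := by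
  rw [B, inner_add_right, real_inner_smul_right, real_inner_comm, inner_right_cross,
    inner_cross_xi hc, mul_zero, zero_add]

theorem inner_B_B (hc : IsSphericalCurve c) (v : ℝ) :
    inner ℝ (B a₁₁ c v) (B a₁₁ c v) = (1 + a₁₁ ^ 2) ^ 2 := by
  nth_rw 1 [B]
  rw [inner_add_left, real_inner_smul_left, inner_deriv_xi_B hc, inner_cross_xi_B hc]
  ring

theorem linearIndependent_xi (ha₀₂ : a₀₂ ≠ 0) (hc : IsSphericalCurve c) :
    LinearIndependent ℝ ![xi a₁₁ c 0, deriv (xi a₁₁ c) 0,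
      (a₀₂ / (1 + a₁₁ ^ 2)) • B a₁₁ c 0] := by
  have hk := (one_add_sq_pos a₁₁).ne'
  have hξξ' := inner_xi_deriv_xi (a₁₁ := a₁₁) hc 0
  refine Fintype.linearIndependent_iff.2 fun r hr => ?_
  simp only [Fin.sum_univ_three, Matrix.cons_val] at hr
  have hcross := congrArg (inner ℝ (cross (xi a₁₁ c 0) (deriv (xi a₁₁ c) 0))) hr
  have hξ := congrArg (inner ℝ (xi a₁₁ c 0)) hr
  have hξ' := congrArg (inner ℝ (deriv (xi a₁₁ c) 0)) hr
  simp only [inner_add_right, real_inner_smul_right, inner_zero_right, inner_xi_xi hc,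
    inner_xi_B hc, inner_deriv_xi_deriv_xi hc, inner_cross_xi_B hc,
    real_inner_comm (xi _ _ _) (cross _ _), real_inner_comm (deriv _ _) (cross _ _),
    inner_left_cross, inner_right_cross] at hcross hξ hξ'
  have h2 : r 2 = 0 := by simpa [hk, ha₀₂] using hcross
  have h0 : r 0 = 0 := by simpa [h2, hξξ'] using hξ
  have h1 : r 1 = 0 := by simpa [h2, h0, hk] using hξ'
  intro i
  fin_cases i <;> assumption

theorem hasDerivAt_gam (hc : ContDiffOn ℝ ∞ c arcInterval) (v : ℝ) :
    HasDerivAt (gam a₁₁ a₀₂ c) (v • (a₀₂ / (1 + a₁₁ ^ 2)) • B a₁₁ c v) v := by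
  have h : Continuous fun t => t • B a₁₁ c t := continuous_id.smul (contDiff_B hc).continuous
  rw [smul_comm]
  exact (h.integral_hasStrictDerivAt 0 v).hasDerivAt.const_smul (a₀₂ / (1 + a₁₁ ^ 2))

theorem contDiff_gam (hc : ContDiffOn ℝ ∞ c arcInterval) : ContDiff ℝ ∞ (gam a₁₁ a₀₂ c) := by
  refine contDiff_infty_iff_deriv.2 ⟨fun v => (hasDerivAt_gam hc v).differentiableAt, ?_⟩
  rw [funext fun v => (hasDerivAt_gam (a₁₁ := a₁₁) (a₀₂ := a₀₂) hc v).deriv]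
  exact contDiff_id.smul ((contDiff_B hc).const_smul _)

theorem contDiff_ruled (hc : ContDiffOn ℝ ∞ c arcInterval) : ContDiff ℝ ∞ (ruled a₁₁ a₀₂ c) := by
  have hγ := contDiff_gam (a₁₁ := a₁₁) (a₀₂ := a₀₂) hc
  have hξ := contDiff_xi (a₁₁ := a₁₁) hc
  unfold ruled
  fun_prop

theorem ruled_zero : ruled a₁₁ a₀₂ c 0 = 0 := by simp [ruled, gam]

theorem isCrossCapAt_ruled_zero (ha₀₂ : a₀₂ ≠ 0) (hc : IsSphericalCurve c) :
    IsCrossCapAt (ruled a₁₁ a₀₂ c) 0 :=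
  isCrossCapAt_ruled (contDiff_xi hc.smooth) ((contDiff_B hc.smooth).const_smul _)
    (contDiff_gam hc.smooth) (hasDerivAt_gam hc.smooth) (linearIndependent_xi ha₀₂ hc)

theorem hasFDerivAt_ruled (hc : ContDiffOn ℝ ∞ c arcInterval) (p : ℝ × ℝ) :
    HasFDerivAt (ruled a₁₁ a₀₂ c)
      ((ContinuousLinearMap.snd ℝ ℝ ℝ).smulRight (p.2 • (a₀₂ / (1 + a₁₁ ^ 2)) • B a₁₁ c p.2) +
        (p.1 • (ContinuousLinearMap.snd ℝ ℝ ℝ).smulRight (deriv (xi a₁₁ c) p.2) +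
          (ContinuousLinearMap.fst ℝ ℝ ℝ).smulRight (xi a₁₁ c p.2))) p := by
  have hγ := (hasDerivAt_gam (a₁₁ := a₁₁) (a₀₂ := a₀₂) hc p.2).hasFDerivAt.comp p
    (hasFDerivAt_snd (𝕜 := ℝ) (p := p))
  have hξ := (hasDerivAt_of_contDiff_infty (contDiff_xi (a₁₁ := a₁₁) hc) p.2).hasFDerivAt.comp p
    (hasFDerivAt_snd (𝕜 := ℝ) (p := p))
  exact hγ.add ((hasFDerivAt_fst (𝕜 := ℝ) (p := p)).smul hξ)

theorem partialU_ruled (hc : ContDiffOn ℝ ∞ c arcInterval) (p : ℝ × ℝ) :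
    partialU (ruled a₁₁ a₀₂ c) p = xi a₁₁ c p.2 := by
  rw [partialU, (hasFDerivAt_ruled hc p).fderiv]
  simp

theorem partialV_ruled (hc : ContDiffOn ℝ ∞ c arcInterval) (p : ℝ × ℝ) :
    partialV (ruled a₁₁ a₀₂ c) p =
      p.2 • (a₀₂ / (1 + a₁₁ ^ 2)) • B a₁₁ c p.2 + p.1 • deriv (xi a₁₁ c) p.2 := by
  rw [partialV, (hasFDerivAt_ruled hc p).fderiv]
  simp

theorem isIsometric_ruled (ha₀₂ : a₀₂ ≠ 0) (hc₁ : IsSphericalCurve c₁)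
    (hc₂ : IsSphericalCurve c₂) : IsIsometric (ruled a₁₁ a₀₂ c₁) (ruled a₁₁ a₀₂ c₂) where
  smooth_left := contDiff_ruled hc₁.smooth
  smooth_right := contDiff_ruled hc₂.smooth
  crossCap_left := isCrossCapAt_ruled_zero ha₀₂ hc₁
  crossCap_right := isCrossCapAt_ruled_zero ha₀₂ hc₂
  uu p := by
    rw [partialU_ruled hc₁.smooth, partialU_ruled hc₂.smooth, inner_xi_xi hc₁, inner_xi_xi hc₂]
  uv p := by
    simp only [partialU_ruled hc₁.smooth, partialU_ruled hc₂.smooth, partialV_ruled hc₁.smooth,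
      partialV_ruled hc₂.smooth, inner_add_right, real_inner_smul_right, inner_xi_deriv_xi hc₁,
      inner_xi_deriv_xi hc₂, inner_xi_B hc₁, inner_xi_B hc₂]
  vv p := by
    simp only [partialV_ruled hc₁.smooth, partialV_ruled hc₂.smooth, inner_add_right,
      inner_add_left, real_inner_smul_right, real_inner_smul_left, inner_deriv_xi_deriv_xi hc₁,
      inner_deriv_xi_deriv_xi hc₂, inner_B_B hc₁, inner_B_B hc₂, inner_deriv_xi_B hc₁,
      inner_deriv_xi_B hc₂, real_inner_comm (deriv _ _) (B _ _ _)]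

end SphericalCurve

section Congruence

variable {a₁₁ a₀₂ : ℝ} {c₁ c₂ : ℝ → E3} {A : E3 ≃ₗᵢ[ℝ] E3}

theorem deriv_xi_map (hc₁ : ContDiffOn ℝ ∞ c₁ arcInterval)
    (h : ∀ v, xi a₁₁ c₂ v = A (xi a₁₁ c₁ v)) (v : ℝ) :
    deriv (xi a₁₁ c₂) v = A (deriv (xi a₁₁ c₁) v) := by
  rw [funext h]
  exact (hasDerivAt_map A (hasDerivAt_of_contDiff_infty (contDiff_xi hc₁) v)).deriv

theorem ruled_map (hc₁ : ContDiffOn ℝ ∞ c₁ arcInterval)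
    (hA : LinearMap.det (A.toLinearEquiv : E3 →ₗ[ℝ] E3) = 1)
    (h : ∀ s ∈ arcInterval, c₂ s = A (c₁ s)) (p : ℝ × ℝ) :
    ruled a₁₁ a₀₂ c₂ p = A (ruled a₁₁ a₀₂ c₁ p) := by
  have hξ : ∀ v, xi a₁₁ c₂ v = A (xi a₁₁ c₁ v) := fun v => by
    rw [xi, xi, map_smul, cHat, cHat, h _ (arctan_mem_arcInterval _)]
  have hB : ∀ v, B a₁₁ c₂ v = A (B a₁₁ c₁ v) := fun v => by
    rw [B, B, deriv_xi_map hc₁ hξ, hξ, cross_map, hA, one_smul, map_add, map_smul]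
  have hint : ∫ t in (0 : ℝ)..p.2, t • B a₁₁ c₂ t = A (∫ t in (0 : ℝ)..p.2, t • B a₁₁ c₁ t) := by
    simp only [hB, ← map_smul]
    exact A.toContinuousLinearEquiv.toContinuousLinearMap.intervalIntegral_comp_comm
      ((continuous_id.smul (contDiff_B hc₁).continuous).intervalIntegrable 0 p.2)
  rw [ruled, ruled, gam, gam, hint, hξ, map_add, map_smul, map_smul]

theorem gam_eq_of_ruled_eq (h : ∀ p, ruled a₁₁ a₀₂ c₂ p = A (ruled a₁₁ a₀₂ c₁ p)) (v : ℝ) :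
    gam a₁₁ a₀₂ c₂ v = A (gam a₁₁ a₀₂ c₁ v) := by
  simpa [ruled] using h (0, v)

theorem xi_eq_of_ruled_eq (h : ∀ p, ruled a₁₁ a₀₂ c₂ p = A (ruled a₁₁ a₀₂ c₁ p)) (v : ℝ) :
    xi a₁₁ c₂ v = A (xi a₁₁ c₁ v) := by
  have h1 := h (1, v)
  simpa only [ruled, one_smul, map_add, gam_eq_of_ruled_eq h, add_right_inj] using h1

theorem curve_eq_of_ruled_eq (h : ∀ p, ruled a₁₁ a₀₂ c₂ p = A (ruled a₁₁ a₀₂ c₁ p)) {s : ℝ}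
    (hs : s ∈ arcInterval) : c₂ s = A (c₁ s) := by
  have hk := (Real.sqrt_pos.2 (one_add_sq_pos a₁₁)).ne'
  have hr := (Real.sqrt_pos.2 (one_add_mul_sq_pos a₁₁ (Real.tan s / √(1 + a₁₁ ^ 2)))).ne'
  have hξ := xi_eq_of_ruled_eq h (Real.tan s / √(1 + a₁₁ ^ 2))
  rw [xi, xi, map_smul, cHat, cHat, div_mul_cancel₀ _ hk, Real.arctan_tan hs.1 hs.2] at hξ
  exact smul_right_injective _ hr hξ

theorem B_eq_of_ruled_eq (ha₀₂ : a₀₂ ≠ 0) (hc₁ : ContDiffOn ℝ ∞ c₁ arcInterval)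
    (hc₂ : ContDiffOn ℝ ∞ c₂ arcInterval) (h : ∀ p, ruled a₁₁ a₀₂ c₂ p = A (ruled a₁₁ a₀₂ c₁ p))
    {v : ℝ} (hv : v ≠ 0) : B a₁₁ c₂ v = A (B a₁₁ c₁ v) := by
  have hγ₂ := hasDerivAt_gam (a₁₁ := a₁₁) (a₀₂ := a₀₂) hc₂ v
  rw [funext (gam_eq_of_ruled_eq h)] at hγ₂
  have hB := hγ₂.unique (hasDerivAt_map A (hasDerivAt_gam hc₁ v))
  rw [map_smul, map_smul] at hB
  exact smul_right_injective _ (div_ne_zero ha₀₂ (one_add_sq_pos a₁₁).ne')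
    (smul_right_injective _ hv hB)

theorem det_eq_one_of_ruled_eq (ha₀₂ : a₀₂ ≠ 0) (hc₁ : ContDiffOn ℝ ∞ c₁ arcInterval)
    (hc₂ : IsSphericalCurve c₂) (h : ∀ p, ruled a₁₁ a₀₂ c₂ p = A (ruled a₁₁ a₀₂ c₁ p)) :
    LinearMap.det (A.toLinearEquiv : E3 →ₗ[ℝ] E3) = 1 := by
  have hξ := xi_eq_of_ruled_eq h
  have hξ' := deriv_xi_map hc₁ hξ
  have hB := B_eq_of_ruled_eq ha₀₂ hc₁ hc₂.smooth h one_ne_zero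
  simp only [B, map_add, map_smul, ← hξ', add_right_inj] at hB
  have hcross := cross_map A (xi a₁₁ c₁ 1) (deriv (xi a₁₁ c₁) 1)
  rw [← hB, ← hξ, ← hξ'] at hcross
  have hinner := congrArg (inner ℝ (cross (xi a₁₁ c₂ 1) (deriv (xi a₁₁ c₂) 1))) hcross
  rw [real_inner_smul_right, inner_cross_xi hc₂] at hinner
  exact (mul_right_cancel₀ (one_add_sq_pos a₁₁).ne' ((one_mul _).trans hinner)).symm

theorem congruent_ruled_iff (hc₁ : ContDiffOn ℝ ∞ c₁ arcInterval) :
    Congruent (ruled a₁₁ a₀₂ c₁) (ruled a₁₁ a₀₂ c₂) ↔ CurveCongruent c₁ c₂ := by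
  constructor
  · rintro ⟨A, b, hA, h⟩
    obtain rfl : b = 0 := by simpa [ruled_zero] using (h 0).symm
    simp only [add_zero] at h
    exact ⟨A, hA, fun s hs => curve_eq_of_ruled_eq h hs⟩
  · rintro ⟨A, hA, h⟩
    exact ⟨A, 0, hA, fun p => by rw [add_zero, ruled_map hc₁ hA h]⟩

theorem congruent_of_isometryEquiv (ha₀₂ : a₀₂ ≠ 0) (hc₁ : ContDiffOn ℝ ∞ c₁ arcInterval)
    (hc₂ : IsSphericalCurve c₂) (T : E3 ≃ᵢ E3)
    (h : ∀ p, ruled a₁₁ a₀₂ c₂ p = T (ruled a₁₁ a₀₂ c₁ p)) :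
    Congruent (ruled a₁₁ a₀₂ c₁) (ruled a₁₁ a₀₂ c₂) := by
  have h0 : T 0 = 0 := by simpa [ruled_zero] using (h 0).symm
  have hlinear : ∀ p, ruled a₁₁ a₀₂ c₂ p =
      T.toRealLinearIsometryEquivOfMapZero h0 (ruled a₁₁ a₀₂ c₁ p) := h
  exact ⟨_, 0, det_eq_one_of_ruled_eq ha₀₂ hc₁ hc₂ hlinear, fun p => by rw [add_zero, hlinear]⟩

end Congruence

section Frame

variable {x y x' y' : E3} {h l : ℝ → ℝ}

theorem orthonormal_cross (hxy : Orthonormal ℝ ![x, y]) : Orthonormal ℝ ![x, y, cross x y] := by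
  obtain ⟨hx, hxy, hy⟩ : ‖x‖ = 1 ∧ inner ℝ x y = 0 ∧ ‖y‖ = 1 := by simpa using hxy
  have hcross : ‖cross x y‖ = 1 := by
    rw [← sq_eq_sq₀ (norm_nonneg _) zero_le_one, ← real_inner_self_eq_norm_sq, inner_cross_cross,
      real_inner_self_eq_norm_sq, real_inner_self_eq_norm_sq, hx, hy, hxy]
    norm_num
  simp [Fin.forall_fin_two, hx, hxy, hy, hcross, inner_left_cross, inner_right_cross]

theorem exists_rotation (hxy : Orthonormal ℝ ![x, y]) (hxy' : Orthonormal ℝ ![x', y']) :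
    ∃ A : E3 ≃ₗᵢ[ℝ] E3, LinearMap.det (A.toLinearEquiv : E3 →ₗ[ℝ] E3) = 1 ∧
      A x = x' ∧ A y = y' := by
  have hframe := orthonormal_cross hxy
  have hframe' := orthonormal_cross hxy'
  have hdim : Fintype.card (Fin 3) = Module.finrank ℝ E3 := by simp
  let b := OrthonormalBasis.mk hframe
    (hframe.linearIndependent.span_eq_top_of_card_eq_finrank' hdim).ge
  let b' := OrthonormalBasis.mk hframe'
    (hframe'.linearIndependent.span_eq_top_of_card_eq_finrank' hdim).ge
  let A := b.equiv b' (Equiv.refl _)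
  have hA (i : Fin 3) : A (![x, y, cross x y] i) = ![x', y', cross x' y'] i := by
    simpa [b, b'] using b.equiv_apply_basis b' (Equiv.refl _) i
  have hAx : A x = x' := hA 0
  have hAy : A y = y' := hA 1
  have hAcross : A (cross x y) = cross x' y' := hA 2
  have hdet := cross_map A x y
  rw [hAx, hAy, hAcross] at hdet
  exact ⟨A, smul_left_injective ℝ (hframe'.ne_zero 2) (hdet.symm.trans (one_smul ℝ _).symm),
    hAx, hAy⟩

/-- The spherical curve with latitude `h` and longitude `l`, measured in the positively oriented
frame `x, y, x × y`, whose last vector is the north pole. -/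
def latLongCurve (x y : E3) (h l : ℝ → ℝ) (s : ℝ) : E3 :=
  (Real.cos (h s) * Real.cos (l s)) • x + (Real.cos (h s) * Real.sin (l s)) • y +
    Real.sin (h s) • cross x y

theorem norm_smul_frame_sq (hxy : Orthonormal ℝ ![x, y]) (a b c : ℝ) :
    ‖a • x + b • y + c • cross x y‖ ^ 2 = a ^ 2 + b ^ 2 + c ^ 2 := by
  rw [← real_inner_self_eq_norm_sq]
  simpa [Fin.sum_univ_three, sq] using
    (orthonormal_cross hxy).inner_sum ![a, b, c] ![a, b, c] Finset.univ

theorem inner_cross_latLongCurve (hxy : Orthonormal ℝ ![x, y]) (s : ℝ) :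
    inner ℝ (cross x y) (latLongCurve x y h l s) = Real.sin (h s) := by
  simpa [Fin.sum_univ_three, latLongCurve] using (orthonormal_cross hxy).inner_right_fintype
    ![Real.cos (h s) * Real.cos (l s), Real.cos (h s) * Real.sin (l s), Real.sin (h s)] 2

theorem norm_deriv_latLongCurve_sq (hxy : Orthonormal ℝ ![x, y]) {s : ℝ}
    (hh : DifferentiableAt ℝ h s) (hl : DifferentiableAt ℝ l s) :
    ‖deriv (latLongCurve x y h l) s‖ ^ 2 = deriv h s ^ 2 + (Real.cos (h s) * deriv l s) ^ 2 := by
  have hderiv : HasDerivAt (latLongCurve x y h l) _ s :=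
    (((hh.hasDerivAt.cos.mul hl.hasDerivAt.cos).smul_const x).add
      ((hh.hasDerivAt.cos.mul hl.hasDerivAt.sin).smul_const y)).add
      (hh.hasDerivAt.sin.smul_const (cross x y))
  rw [hderiv.deriv, norm_smul_frame_sq hxy]
  linear_combination
    (deriv h s ^ 2 * Real.sin (h s) ^ 2 + (Real.cos (h s) * deriv l s) ^ 2) *
      Real.cos_sq_add_sin_sq (l s) + deriv h s ^ 2 * Real.cos_sq_add_sin_sq (h s)

theorem isSphericalCurve_latLongCurve (hxy : Orthonormal ℝ ![x, y]) (hh : ContDiff ℝ ∞ h)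
    (hl : ContDiff ℝ ∞ l)
    (hspeed : ∀ s ∈ arcInterval, deriv h s ^ 2 + (Real.cos (h s) * deriv l s) ^ 2 = 1) :
    IsSphericalCurve (latLongCurve x y h l) where
  smooth := by
    unfold latLongCurve
    fun_prop
  mem_sphere s _ := by
    rw [mem_sphere_zero_iff_norm, ← sq_eq_sq₀ (norm_nonneg _) zero_le_one, latLongCurve,
      norm_smul_frame_sq hxy]
    linear_combination Real.cos (h s) ^ 2 * Real.cos_sq_add_sin_sq (l s) +
      Real.cos_sq_add_sin_sq (h s)
  unit_speed s hs := by
    rw [← sq_eq_sq₀ (norm_nonneg _) zero_le_one, norm_deriv_latLongCurve_sq hxy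
      (hh.differentiable (by simp) s) (hl.differentiable (by simp) s), hspeed s hs, one_pow]

end Frame

section GreatCircle

variable {x y : E3} {c : ℝ → E3}

/-- The arc length parametrization of the great circle through `x` in the direction `y`. -/
def greatCircle (x y : E3) (s : ℝ) : E3 := Real.cos s • x + Real.sin s • y

theorem latLongCurve_zero_id : latLongCurve x y (fun _ => 0) id = greatCircle x y := by
  funext s
  simp [latLongCurve, greatCircle]

theorem isSphericalCurve_greatCircle (hxy : Orthonormal ℝ ![x, y]) :
    IsSphericalCurve (greatCircle x y) :=
  latLongCurve_zero_id ▸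
    isSphericalCurve_latLongCurve hxy contDiff_const contDiff_id fun s _ => by simp

theorem deriv_greatCircle (x y : E3) : deriv (greatCircle x y) = greatCircle y (-x) := by
  funext s
  have hderiv : HasDerivAt (greatCircle x y) _ s :=
    ((Real.hasDerivAt_cos s).smul_const x).add ((Real.hasDerivAt_sin s).smul_const y)
  rw [hderiv.deriv, greatCircle]
  module

theorem map_greatCircle (A : E3 ≃ₗᵢ[ℝ] E3) (s : ℝ) :
    A (greatCircle x y s) = greatCircle (A x) (A y) s := by
  simp only [greatCircle, map_add, map_smul]

theorem zero_mem_arcInterval : (0 : ℝ) ∈ arcInterval := by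
  simp [arcInterval, Real.pi_pos]

theorem IsSphericalCurve.hasDerivAt_deriv (hc : IsSphericalCurve c) {s : ℝ}
    (hs : s ∈ arcInterval) : HasDerivAt (deriv c) (deriv (deriv c) s) s := by
  have hsmooth := ((contDiffOn_infty_iff_deriv_of_isOpen isOpen_arcInterval).1 hc.smooth).2
  exact ((hsmooth.contDiffAt (isOpen_arcInterval.mem_nhds hs)).differentiableAt
    (by simp)).hasDerivAt

theorem IsSphericalCurve.inner_deriv_deriv_self (hc : IsSphericalCurve c) {s : ℝ}
    (hs : s ∈ arcInterval) : inner ℝ (deriv (deriv c) s) (c s) = -1 := by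
  have hderiv := (hc.hasDerivAt hs).inner ℝ (hc.hasDerivAt_deriv hs)
  have hconst : (fun t => inner ℝ (c t) (deriv c t)) =ᶠ[𝓝 s] fun _ => (0 : ℝ) := by
    filter_upwards [isOpen_arcInterval.mem_nhds hs] with t ht using hc.inner_deriv ht
  have hzero := hderiv.unique ((hasDerivAt_const s (0 : ℝ)).congr_of_eventuallyEq hconst)
  rw [hc.inner_deriv_deriv hs] at hzero
  rw [real_inner_comm]
  linarith

theorem isSphericalGeodesic_iff (hc : IsSphericalCurve c) :
    IsSphericalGeodesic c ↔ EqOn (deriv (deriv c)) (-c) arcInterval := by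
  refine forall₂_congr fun s hs => ?_
  rw [hc.inner_deriv_deriv_self hs, neg_one_smul, sub_neg_eq_add, Pi.neg_apply,
    eq_neg_iff_add_eq_zero]

theorem eqOn_greatCircle (hc : IsSphericalCurve c)
    (hgeod : EqOn (deriv (deriv c)) (-c) arcInterval) :
    EqOn c (greatCircle (c 0) (deriv c 0)) arcInterval := by
  intro s hs
  have hconst {F : ℝ → E3} (hF : ∀ t ∈ arcInterval, HasDerivAt F 0 t) : F s = F 0 :=
    isOpen_arcInterval.is_const_of_deriv_eq_zero isPreconnected_Ioo
      (fun t ht => (hF t ht).differentiableAt.differentiableWithinAt)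
      (fun t ht => (hF t ht).deriv) hs zero_mem_arcInterval
  -- Rotating the pair `(c, c')` back by the angle `t` gives a constant pair.
  have hstart := hconst (F := fun t => Real.cos t • c t - Real.sin t • deriv c t) fun t ht => by
    refine (((Real.hasDerivAt_cos t).smul (hc.hasDerivAt ht)).sub
      ((Real.hasDerivAt_sin t).smul (hc.hasDerivAt_deriv ht))).congr_deriv ?_
    rw [hgeod ht, Pi.neg_apply]
    module
  have hspeed := hconst (F := fun t => Real.sin t • c t + Real.cos t • deriv c t) fun t ht => by
    refine (((Real.hasDerivAt_sin t).smul (hc.hasDerivAt ht)).add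
      ((Real.hasDerivAt_cos t).smul (hc.hasDerivAt_deriv ht))).congr_deriv ?_
    rw [hgeod ht, Pi.neg_apply]
    module
  simp only [Real.cos_zero, Real.sin_zero, one_smul, zero_smul, sub_zero, zero_add]
    at hstart hspeed
  calc c s = (Real.cos s ^ 2 + Real.sin s ^ 2) • c s := by
        rw [Real.cos_sq_add_sin_sq, one_smul]
    _ = greatCircle (c 0) (deriv c 0) s := by
        rw [greatCircle, ← hstart, ← hspeed]
        module

theorem curveCongruent_greatCircle_iff (hxy : Orthonormal ℝ ![x, y]) (hc : IsSphericalCurve c) :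
    CurveCongruent c (greatCircle x y) ↔ IsSphericalGeodesic c := by
  rw [isSphericalGeodesic_iff hc]
  constructor
  · rintro ⟨A, -, hA⟩
    have hc_eq : EqOn c (greatCircle (A.symm x) (A.symm y)) arcInterval := fun s hs => by
      rw [← map_greatCircle, hA s hs, A.symm_apply_apply]
    intro s hs
    rw [(hc_eq.deriv isOpen_arcInterval).deriv isOpen_arcInterval hs, deriv_greatCircle,
      deriv_greatCircle, Pi.neg_apply, hc_eq hs, greatCircle, greatCircle]
    module
  · intro hgeod
    have hframe : Orthonormal ℝ ![c 0, deriv c 0] := by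
      simpa [hc.unit_speed 0 zero_mem_arcInterval, hc.inner_deriv zero_mem_arcInterval] using
        hc.mem_sphere 0 zero_mem_arcInterval
    obtain ⟨A, hA, hAx, hAy⟩ := exists_rotation hframe hxy
    refine ⟨A, hA, fun s hs => ?_⟩
    rw [eqOn_greatCircle hc hgeod hs, map_greatCircle, hAx, hAy]

end GreatCircle

section StandardCrossCap

variable {a₁₁ a₀₂ : ℝ} {x y : E3}

theorem xi_greatCircle (v : ℝ) :
    xi a₁₁ (greatCircle x y) v = x + v • √(1 + a₁₁ ^ 2) • y := by
  have hsq : 1 + (v * √(1 + a₁₁ ^ 2)) ^ 2 = 1 + (1 + a₁₁ ^ 2) * v ^ 2 := by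
    rw [mul_pow, Real.sq_sqrt (one_add_sq_pos a₁₁).le]
    ring
  have hsqrt := (Real.sqrt_pos.2 (one_add_mul_sq_pos a₁₁ v)).ne'
  rw [xi, cHat, greatCircle, Real.cos_arctan, Real.sin_arctan, hsq, smul_add, smul_smul, smul_smul,
    mul_one_div_cancel hsqrt, mul_div_cancel₀ _ hsqrt, one_smul, mul_smul]

theorem deriv_xi_greatCircle (v : ℝ) :
    deriv (xi a₁₁ (greatCircle x y)) v = √(1 + a₁₁ ^ 2) • y := by
  rw [funext xi_greatCircle, deriv_const_add, deriv_smul_const differentiableAt_id, deriv_id'',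
    one_smul]

/-- The first vector of the frame in which the great circle of `f₀` starts. -/
def frameOne : E3 := !₂[1, 0, 0]

/-- The second vector of that frame, the direction of `(0, 1, a₁₁)`. -/
def frameTwo (a₁₁ : ℝ) : E3 := (√(1 + a₁₁ ^ 2))⁻¹ • !₂[0, 1, a₁₁]

theorem sqrt_smul_frameTwo (a₁₁ : ℝ) : √(1 + a₁₁ ^ 2) • frameTwo a₁₁ = !₂[0, 1, a₁₁] :=
  smul_inv_smul₀ (Real.sqrt_pos.2 (one_add_sq_pos a₁₁)).ne' _

theorem orthonormal_frame (a₁₁ : ℝ) : Orthonormal ℝ ![frameOne, frameTwo a₁₁] := by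
  have hOne : ‖frameOne‖ = 1 := by
    simp [frameOne, EuclideanSpace.norm_eq, Fin.sum_univ_three]
  have hTwo : ‖frameTwo a₁₁‖ = 1 := by
    have hnorm : ‖(!₂[0, 1, a₁₁] : E3)‖ = √(1 + a₁₁ ^ 2) := by
      simp [EuclideanSpace.norm_eq, Fin.sum_univ_three]
    rw [frameTwo, norm_smul, hnorm, norm_inv, Real.norm_of_nonneg (Real.sqrt_nonneg _),
      inv_mul_cancel₀ (Real.sqrt_pos.2 (one_add_sq_pos a₁₁)).ne']
  have hinner : inner ℝ frameOne (frameTwo a₁₁) = 0 := by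
    simp [inner_eq_dotProduct, frameOne, frameTwo]
  simp [hOne, hTwo, hinner]

theorem B_greatCircle_frame (v : ℝ) :
    B a₁₁ (greatCircle frameOne (frameTwo a₁₁)) v = !₂[0, 0, 1 + a₁₁ ^ 2] := by
  rw [B, deriv_xi_greatCircle, xi_greatCircle, sqrt_smul_frameTwo, cross, cross_apply]
  ext i
  fin_cases i <;> simp [frameOne]
  ring

theorem gam_greatCircle_frame (v : ℝ) :
    gam a₁₁ a₀₂ (greatCircle frameOne (frameTwo a₁₁)) v =
      (1 / 2 : ℝ) • !₂[0, 0, a₀₂ * v ^ 2] := by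
  have hne := (one_add_sq_pos a₁₁).ne'
  simp only [gam, B_greatCircle_frame]
  rw [intervalIntegral.integral_smul_const, integral_id]
  ext i
  fin_cases i
  · simp
  · simp
  · simp
    field_simp

theorem ruled_greatCircle_frame (a₁₁ a₀₂ : ℝ) :
    ruled a₁₁ a₀₂ (greatCircle frameOne (frameTwo a₁₁)) = f₀ a₁₁ a₀₂ := by
  funext p
  rw [ruled, f₀, gam_greatCircle_frame, xi_greatCircle, sqrt_smul_frameTwo]
  congr 2
  ext i
  fin_cases i <;> simp [frameOne, mul_comm]

end StandardCrossCap

section SmoothFamily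

variable {X : Type} [NormedAddCommGroup X] [NormedSpace ℝ X]

theorem contDiff_xi_family {c : X → ℝ → E3} (a₁₁ : ℝ)
    (hc : ContDiff ℝ ∞ fun q : X × ℝ => c q.1 q.2) :
    ContDiff ℝ ∞ fun q : X × ℝ => xi a₁₁ (c q.1) q.2 := by
  have harctan : ContDiff ℝ ∞ fun q : X × ℝ => Real.arctan (q.2 * √(1 + a₁₁ ^ 2)) :=
    Real.contDiff_arctan.comp (by fun_prop)
  exact ((contDiff_sqrt_one_add a₁₁).comp contDiff_snd).smul (hc.comp (contDiff_fst.prodMk harctan))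

theorem contDiff_deriv_family {g : X → ℝ → E3} (hg : ContDiff ℝ ∞ fun q : X × ℝ => g q.1 q.2) :
    ContDiff ℝ ∞ fun q : X × ℝ => deriv (g q.1) q.2 := by
  have hderiv (q : X × ℝ) :
      deriv (g q.1) q.2 = fderiv ℝ (fun q : X × ℝ => g q.1 q.2) q (0, 1) := by
    have hline : HasDerivAt (fun s : ℝ => (q.1, s)) ((0, 1) : X × ℝ) q.2 :=
      (hasDerivAt_const q.2 q.1).prodMk (hasDerivAt_id q.2)
    exact ((hg.differentiable (by simp) q).hasFDerivAt.comp_hasDerivAt q.2 hline).deriv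
  simp only [hderiv]
  exact (contDiff_infty_iff_fderiv.1 hg).2.clm_apply contDiff_const

theorem contDiff_ruled_family {c : X → ℝ → E3} (a₁₁ a₀₂ : ℝ)
    (hc : ContDiff ℝ ∞ fun q : X × ℝ => c q.1 q.2) :
    ContDiff ℝ ∞ fun q : X × (ℝ × ℝ) => ruled a₁₁ a₀₂ (c q.1) q.2 := by
  have hxi := contDiff_xi_family a₁₁ hc
  have hxi' := contDiff_deriv_family (g := fun t => xi a₁₁ (c t)) hxi
  have hB : ContDiff ℝ ∞ fun q : X × ℝ => B a₁₁ (c q.1) q.2 :=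
    (hxi'.const_smul a₁₁).add (contDiff_cross hxi hxi')
  have hgam : ContDiff ℝ ∞ fun q : X × ℝ => gam a₁₁ a₀₂ (c q.1) q.2 :=
    (contDiff_parametric_primitive (contDiff_snd.smul hB) 0).const_smul _
  have hproj : ContDiff ℝ ∞ fun q : X × (ℝ × ℝ) => (q.1, q.2.2) := by fun_prop
  exact (hgam.comp hproj).add ((contDiff_fst.comp contDiff_snd).smul (hxi.comp hproj))

end SmoothFamily

section Deformation

variable {N : ℕ} {x y : E3} {t t' : EuclideanSpace ℝ (Fin N)}

/-- The derivative of the latitude of the curves of the deformation. It is flat at `s = 0` and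
vanishes for `s ≤ 0`, while its germ on the right of `0` determines `t`; the factor
`1 / (4 (1 + s²))` keeps it and its integral small enough for a unit speed curve. -/
def latSlope (t : EuclideanSpace ℝ (Fin N)) (s : ℝ) : ℝ :=
  Real.arctan (expNegInvGlue s * ∑ i : Fin N, t i * s ^ (i : ℕ)) / (4 * (1 + s ^ 2))

/-- The latitude of the curves of the deformation. -/
def latitude (t : EuclideanSpace ℝ (Fin N)) (s : ℝ) : ℝ := ∫ σ in (0 : ℝ)..s, latSlope t σ

/-- The derivative of the longitude, chosen so that the curves of the deformation have unit
speed. -/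
def lonSlope (t : EuclideanSpace ℝ (Fin N)) (s : ℝ) : ℝ :=
  √(1 - latSlope t s ^ 2) / Real.cos (latitude t s)

/-- The longitude of the curves of the deformation. -/
def longitude (t : EuclideanSpace ℝ (Fin N)) (s : ℝ) : ℝ := ∫ σ in (0 : ℝ)..s, lonSlope t σ

/-- The curves of the deformation: great circles bent, for `s > 0` only, as prescribed by `t`. -/
def deformedCircle (x y : E3) (t : EuclideanSpace ℝ (Fin N)) : ℝ → E3 :=
  latLongCurve x y (latitude t) (longitude t)

theorem contDiff_latSlope :
    ContDiff ℝ ∞ fun q : EuclideanSpace ℝ (Fin N) × ℝ => latSlope q.1 q.2 := by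
  have hglue : ContDiff ℝ ∞ fun q : EuclideanSpace ℝ (Fin N) × ℝ => expNegInvGlue q.2 :=
    expNegInvGlue.contDiff.comp contDiff_snd
  refine (Real.contDiff_arctan.comp (hglue.mul (by fun_prop))).div (by fun_prop) fun q => ?_
  positivity

theorem abs_latSlope_le (t : EuclideanSpace ℝ (Fin N)) (s : ℝ) :
    |latSlope t s| ≤ 1 / 2 * (1 / (1 + s ^ 2)) := by
  have harctan (r : ℝ) : |Real.arctan r| ≤ 2 :=
    abs_le.2 ⟨by linarith [Real.neg_pi_div_two_lt_arctan r, Real.pi_lt_four],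
      by linarith [Real.arctan_lt_pi_div_two r, Real.pi_lt_four]⟩
  rw [latSlope, abs_div, abs_of_pos (by positivity : 0 < 4 * (1 + s ^ 2))]
  calc _ ≤ 2 / (4 * (1 + s ^ 2)) := by
        gcongr
        exact harctan _
    _ = 1 / 2 * (1 / (1 + s ^ 2)) := by
        field_simp
        norm_num

theorem one_sub_latSlope_sq_pos (t : EuclideanSpace ℝ (Fin N)) (s : ℝ) :
    0 < 1 - latSlope t s ^ 2 := by
  have hle : 1 / (1 + s ^ 2) ≤ 1 := div_le_one_of_le₀ (by linarith [sq_nonneg s]) (by positivity)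
  have hlt : |latSlope t s| < 1 := by linarith [abs_latSlope_le t s]
  exact sub_pos.2 ((sq_lt_one_iff_abs_lt_one _).2 hlt)

theorem abs_latitude_lt (t : EuclideanSpace ℝ (Fin N)) (s : ℝ) :
    |latitude t s| < Real.pi / 2 := by
  have hcont : Continuous fun s : ℝ => 1 / 2 * (1 / (1 + s ^ 2)) :=
    continuous_const.mul (continuous_const.div (by fun_prop) fun s => by positivity)
  have harctan : |Real.arctan s| < Real.pi / 2 :=
    abs_lt.2 ⟨Real.neg_pi_div_two_lt_arctan _, Real.arctan_lt_pi_div_two _⟩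
  calc |latitude t s| ≤ |∫ σ in (0 : ℝ)..s, 1 / 2 * (1 / (1 + σ ^ 2))| :=
        intervalIntegral.norm_integral_le_abs_of_norm_le (f := latSlope t)
          (Eventually.of_forall fun σ => abs_latSlope_le t σ) (hcont.intervalIntegrable _ _)
    _ = 1 / 2 * |Real.arctan s| := by
        rw [intervalIntegral.integral_const_mul, integral_one_div_one_add_sq, Real.arctan_zero,
          sub_zero, abs_mul, abs_of_pos one_half_pos]
    _ < Real.pi / 2 := by linarith [abs_nonneg (Real.arctan s)]

theorem cos_latitude_pos (t : EuclideanSpace ℝ (Fin N)) (s : ℝ) : 0 < Real.cos (latitude t s) :=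
  Real.cos_pos_of_mem_Ioo (abs_lt.1 (abs_latitude_lt t s))

theorem contDiff_latitude :
    ContDiff ℝ ∞ fun q : EuclideanSpace ℝ (Fin N) × ℝ => latitude q.1 q.2 :=
  contDiff_parametric_primitive contDiff_latSlope 0

theorem contDiff_lonSlope :
    ContDiff ℝ ∞ fun q : EuclideanSpace ℝ (Fin N) × ℝ => lonSlope q.1 q.2 :=
  ((contDiff_const.sub (contDiff_latSlope.pow 2)).sqrt
    fun q => (one_sub_latSlope_sq_pos q.1 q.2).ne').div
    (Real.contDiff_cos.comp contDiff_latitude) fun q => (cos_latitude_pos q.1 q.2).ne'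

theorem contDiff_longitude :
    ContDiff ℝ ∞ fun q : EuclideanSpace ℝ (Fin N) × ℝ => longitude q.1 q.2 :=
  contDiff_parametric_primitive contDiff_lonSlope 0

theorem contDiff_deformedCircle (x y : E3) :
    ContDiff ℝ ∞ fun q : EuclideanSpace ℝ (Fin N) × ℝ => deformedCircle x y q.1 q.2 := by
  have hlat := contDiff_latitude (N := N)
  have hlon := contDiff_longitude (N := N)
  unfold deformedCircle latLongCurve
  fun_prop

theorem deriv_latitude (t : EuclideanSpace ℝ (Fin N)) (s : ℝ) :
    deriv (latitude t) s = latSlope t s :=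
  (contDiff_latSlope.continuous.comp (.prodMk_right t)).deriv_integral _ 0 s

theorem deriv_longitude (t : EuclideanSpace ℝ (Fin N)) (s : ℝ) :
    deriv (longitude t) s = lonSlope t s :=
  (contDiff_lonSlope.continuous.comp (.prodMk_right t)).deriv_integral _ 0 s

theorem isSphericalCurve_deformedCircle (hxy : Orthonormal ℝ ![x, y])
    (t : EuclideanSpace ℝ (Fin N)) : IsSphericalCurve (deformedCircle x y t) := by
  have hline : ContDiff ℝ ∞ fun s : ℝ => (t, s) := contDiff_prodMk_right t
  have hlat := contDiff_latitude.comp hline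
  have hlon := contDiff_longitude.comp hline
  refine isSphericalCurve_latLongCurve hxy hlat hlon fun s _ => ?_
  rw [deriv_latitude, deriv_longitude, lonSlope, mul_div_cancel₀ _ (cos_latitude_pos t s).ne',
    Real.sq_sqrt (one_sub_latSlope_sq_pos t s).le, add_sub_cancel]

theorem deformedCircle_eq_greatCircle {s : ℝ} (h : ∀ σ ∈ uIcc 0 s, latSlope t σ = 0) :
    deformedCircle x y t s = greatCircle x y s := by
  have hlat : ∀ σ ∈ uIcc 0 s, latitude t σ = 0 := fun σ hσ =>
    (intervalIntegral.integral_congr fun τ hτ => h τ (uIcc_subset_uIcc_left hσ hτ)).trans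
      intervalIntegral.integral_zero
  have hlon : longitude t s = s := calc
    longitude t s = ∫ _ in (0 : ℝ)..s, (1 : ℝ) :=
      intervalIntegral.integral_congr fun σ hσ => by simp [lonSlope, h σ hσ, hlat σ hσ]
    _ = s := by simp
  simp [deformedCircle, latLongCurve, greatCircle, hlat s right_mem_uIcc, hlon]

theorem deformedCircle_of_nonpos {s : ℝ} (hs : s ≤ 0) :
    deformedCircle x y t s = greatCircle x y s := by
  refine deformedCircle_eq_greatCircle fun σ hσ => ?_
  rw [uIcc_of_ge hs] at hσ
  simp [latSlope, expNegInvGlue.zero_of_nonpos hσ.2]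

theorem deformedCircle_zero :
    deformedCircle x y (0 : EuclideanSpace ℝ (Fin N)) = greatCircle x y := by
  funext s
  exact deformedCircle_eq_greatCircle fun σ _ => by simp [latSlope]

theorem eq_of_latSlope_eqOn (h : EqOn (latSlope t) (latSlope t') arcInterval) : t = t' := by
  let P (t : EuclideanSpace ℝ (Fin N)) : Polynomial ℝ :=
    ∑ i : Fin N, Polynomial.C (t i) * Polynomial.X ^ (i : ℕ)
  have hP : P t = P t' := by
    refine Polynomial.eq_of_infinite_eval_eq _ _
      ((Set.Ioo_infinite (half_pos Real.pi_pos)).mono fun s hs => ?_)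
    have hslope := h ⟨by linarith [hs.1, Real.pi_pos], hs.2⟩
    simp only [latSlope] at hslope
    rw [div_left_inj' (by positivity), Real.arctan_inj,
      mul_right_inj' (expNegInvGlue.pos_of_pos hs.1).ne'] at hslope
    simpa [P, Polynomial.eval_finsetSum] using hslope
  ext i
  simpa [P, Polynomial.finsetSum_coeff, Polynomial.coeff_X_pow, Fin.val_inj] using
    congrArg (Polynomial.coeff · i) hP

theorem eq_of_latitude_eqOn (h : EqOn (latitude t) (latitude t') arcInterval) : t = t' := by
  refine eq_of_latSlope_eqOn fun s hs => ?_
  rw [← deriv_latitude, ← deriv_latitude]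
  exact h.deriv isOpen_arcInterval hs

theorem map_frame_eq_of_map_greatCircle_eq (A : E3 ≃ₗᵢ[ℝ] E3)
    (h : ∀ s ∈ arcInterval, s ≤ 0 → A (greatCircle x y s) = greatCircle x y s) :
    A x = x ∧ A y = y := by
  have hx : A x = x := by simpa [greatCircle] using h 0 zero_mem_arcInterval le_rfl
  refine ⟨hx, ?_⟩
  have hpi := Real.pi_pos
  have hmap := h (-(Real.pi / 4)) ⟨by linarith, by linarith⟩ (by linarith)
  simp only [greatCircle, map_add, map_smul, hx, add_right_inj, Real.sin_neg,
    Real.sin_pi_div_four] at hmap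
  exact smul_right_injective _ (neg_ne_zero.2 (by positivity)) hmap

theorem eq_of_curveCongruent (hxy : Orthonormal ℝ ![x, y])
    (h : CurveCongruent (deformedCircle x y t) (deformedCircle x y t')) : t = t' := by
  obtain ⟨A, hdet, hA⟩ := h
  -- The curves agree on a great circle arc, which pins down the rotation and hence the pole.
  obtain ⟨hAx, hAy⟩ : A x = x ∧ A y = y := map_frame_eq_of_map_greatCircle_eq A fun s hs hs₀ => by
    rw [← deformedCircle_of_nonpos (t := t) hs₀, ← hA s hs, deformedCircle_of_nonpos hs₀,
      deformedCircle_of_nonpos hs₀]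
  have hpole : A (cross x y) = cross x y := by
    simpa [hdet, hAx, hAy] using (cross_map A x y).symm
  refine eq_of_latitude_eqOn fun s hs => ?_
  refine Real.injOn_sin (abs_le.1 (abs_latitude_lt t s).le) (abs_le.1 (abs_latitude_lt t' s).le) ?_
  calc Real.sin (latitude t s) = inner ℝ (cross x y) (deformedCircle x y t s) :=
        (inner_cross_latLongCurve hxy s).symm
    _ = inner ℝ (A (cross x y)) (A (deformedCircle x y t s)) := (A.inner_map_map _ _).symm
    _ = inner ℝ (cross x y) (deformedCircle x y t' s) := by rw [hpole, hA s hs]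
    _ = Real.sin (latitude t' s) := inner_cross_latLongCurve hxy s

end Deformation

end CrossCap

end

open CrossCap in
theorem theorem2p2_general (a₁₁ a₀₂ : ℝ) (ha₀₂ : a₀₂ ≠ 0) :
    (∀ c : ℝ → E3, IsSphericalCurve c →
      IsCrossCapAt (ruled a₁₁ a₀₂ c) 0 ∧ IsIsometric (ruled a₁₁ a₀₂ c) (f₀ a₁₁ a₀₂)) ∧
    (∀ c₁ c₂ : ℝ → E3, IsSphericalCurve c₁ → IsSphericalCurve c₂ →
      (CrossCap.Congruent (ruled a₁₁ a₀₂ c₁) (ruled a₁₁ a₀₂ c₂) ↔ CurveCongruent c₁ c₂)) ∧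
    (∀ c₁ c₂ : ℝ → E3, IsSphericalCurve c₁ → IsSphericalCurve c₂ →
      (∃ T : E3 ≃ᵢ E3, ∀ p, ruled a₁₁ a₀₂ c₂ p = T (ruled a₁₁ a₀₂ c₁ p)) →
      CrossCap.Congruent (ruled a₁₁ a₀₂ c₁) (ruled a₁₁ a₀₂ c₂)) ∧
    (∀ c : ℝ → E3, IsSphericalCurve c →
      (CrossCap.Congruent (ruled a₁₁ a₀₂ c) (f₀ a₁₁ a₀₂) ↔ IsSphericalGeodesic c)) ∧
    (∀ N : ℕ, ∃ c : EuclideanSpace ℝ (Fin N) → ℝ → E3,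
      (∀ t, IsSphericalCurve (c t)) ∧
      ruled a₁₁ a₀₂ (c 0) = f₀ a₁₁ a₀₂ ∧
      IsIsometricDeformation (fun t => ruled a₁₁ a₀₂ (c t)) ∧
      ∀ t t', CrossCap.Congruent (ruled a₁₁ a₀₂ (c t)) (ruled a₁₁ a₀₂ (c t')) → t = t') := by
  have hframe := orthonormal_frame a₁₁
  have hf₀ := ruled_greatCircle_frame a₁₁ a₀₂
  refine ⟨fun c hc => ⟨isCrossCapAt_ruled_zero ha₀₂ hc, ?_⟩,
    fun c₁ c₂ hc₁ _ => congruent_ruled_iff hc₁.smooth,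
    fun c₁ c₂ hc₁ hc₂ ⟨T, hT⟩ => congruent_of_isometryEquiv ha₀₂ hc₁.smooth hc₂ T hT,
    fun c hc => ?_, fun N => ?_⟩
  · rw [← hf₀]
    exact isIsometric_ruled ha₀₂ hc (isSphericalCurve_greatCircle hframe)
  · rw [← hf₀, congruent_ruled_iff hc.smooth, curveCongruent_greatCircle_iff hframe hc]
  · have hcurve := isSphericalCurve_deformedCircle (N := N) hframe
    refine ⟨deformedCircle frameOne (frameTwo a₁₁), hcurve, by rw [deformedCircle_zero, hf₀],
      ⟨contDiff_ruled_family a₁₁ a₀₂ (contDiff_deformedCircle _ _),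
        fun t => isIsometric_ruled ha₀₂ (hcurve t) (hcurve 0)⟩, fun t t' h => ?_⟩
    exact eq_of_curveCongruent hframe ((congruent_ruled_iff (hcurve t).smooth).1 h)

theorem theorem2p2 (a₁₁ a₀₂ : ℝ) (ha₀₂ : 0 < a₀₂) :
    -- `f_c` is smooth, has a cross cap at the origin, and is isometric to `f₀`
    (∀ c : ℝ → CrossCap.E3, CrossCap.IsSphericalCurve c →
      CrossCap.IsCrossCapAt (CrossCap.ruled a₁₁ a₀₂ c) 0 ∧
      CrossCap.IsIsometric (CrossCap.ruled a₁₁ a₀₂ c) (CrossCap.f₀ a₁₁ a₀₂)) ∧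
    -- congruence of the surfaces is congruence of the spherical curves
    (∀ c₁ c₂ : ℝ → CrossCap.E3, CrossCap.IsSphericalCurve c₁ → CrossCap.IsSphericalCurve c₂ →
      (CrossCap.Congruent (CrossCap.ruled a₁₁ a₀₂ c₁) (CrossCap.ruled a₁₁ a₀₂ c₂) ↔
        CrossCap.CurveCongruent c₁ c₂)) ∧
    -- surfaces that differ by any isometry of space are already congruent
    (∀ c₁ c₂ : ℝ → CrossCap.E3, CrossCap.IsSphericalCurve c₁ → CrossCap.IsSphericalCurve c₂ →
      (∃ T : CrossCap.E3 ≃ᵢ CrossCap.E3,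
        ∀ p, CrossCap.ruled a₁₁ a₀₂ c₂ p = T (CrossCap.ruled a₁₁ a₀₂ c₁ p)) →
      CrossCap.Congruent (CrossCap.ruled a₁₁ a₀₂ c₁) (CrossCap.ruled a₁₁ a₀₂ c₂)) ∧
    -- `f₀` corresponds to the geodesics
    (∀ c : ℝ → CrossCap.E3, CrossCap.IsSphericalCurve c →
      (CrossCap.Congruent (CrossCap.ruled a₁₁ a₀₂ c) (CrossCap.f₀ a₁₁ a₀₂) ↔
        CrossCap.IsSphericalGeodesic c)) ∧
    -- infinite-dimensional freedom: for every `N` there is an isometric deformation of `f₀` with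
    -- `N` parameters through surfaces `f_c`, whose members are pairwise not congruent
    (∀ N : ℕ, ∃ c : EuclideanSpace ℝ (Fin N) → ℝ → CrossCap.E3,
      (∀ t, CrossCap.IsSphericalCurve (c t)) ∧
      CrossCap.ruled a₁₁ a₀₂ (c 0) = CrossCap.f₀ a₁₁ a₀₂ ∧
      CrossCap.IsIsometricDeformation (fun t => CrossCap.ruled a₁₁ a₀₂ (c t)) ∧
      ∀ t t', CrossCap.Congruent (CrossCap.ruled a₁₁ a₀₂ (c t)) (CrossCap.ruled a₁₁ a₀₂ (c t')) →
        t = t') :=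
  theorem2p2_general a₁₁ a₀₂ ha₀₂.ne'
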